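/- A spherical polygon is a closed region of the unit sphere $S^2$ bounded by a simple closed curve consisting of $n\ge 3$ great-circle arcs of length less than $\pi$; it need not be convex, and its interior angles lie in $(0,2\pi)$. An edge-to-edge tiling of $S^2$ is a finite family of spherical polygons (the tiles) that cover $S^2$ and have pairwise disjoint interiors, such that every vertex of a tile that lies in another tile is also a vertex of that tile, and such that at least three tiles meet at every vertex. Let $m\ge 4$. Let $P$ be a regular spherical $m$-gon with all edges of length $x$ and all angles equal to $\alpha$. Let $Q$ be a spherical quadrilateral with edges $x,y,x,y$ in cyclic order, where $x\ne y$, and with angles $\beta,\gamma,\beta,\gamma$ in cyclic order, where $\beta>\gamma$. Consider an edge-to-edge tiling of $S^2$ in which every tile is congruent (by an isometry of the sphere, possibly orientation-reversing) to $P$ or to $Q$, and in which both prototiles occur. Then the tiling has no vertex of type $\alpha\beta^2$. That is, there is no vertex at which exactly three tile corners meet, one of them a corner of a copy of $P$ and the other two corners of angle $\beta$ of copies of $Q$. -/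

import Mathlib

/-- Euclidean three-space. -/
abbrev E3 : Type := EuclideanSpace ℝ (Fin 3)

/-- The unit sphere, with the topology induced from three-space. -/
abbrev S2 : Type := Metric.sphere (0 : E3) 1

/-- The great-circle arc of length less than `π` between two points of the sphere that are
neither equal nor antipodal. -/
def arc (p q : S2) : Set S2 :=
  {z | ∃ a b : ℝ, 0 ≤ a ∧ 0 ≤ b ∧ (z : E3) = a • (p : E3) + b • (q : E3)}

/-- `IsInteriorAngle R p q r θ`: the region `R` has at its corner `p`, between the arcs
from `p` to `q` and from `p` to `r`, the interior angle `θ`, where `0 < θ < 2π`.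
Here `u` is the unit tangent vector at `p` that points to `q`, and `(u, e)` is an
orthonormal basis of the tangent plane at `p`. The arc to `r` leaves `p` in the direction at
angle `θ` from `u`, and near `p` the region `R` consists exactly of the points that are seen
from `p` in a direction at an angle between `0` and `θ`. -/
def IsInteriorAngle (R : Set S2) (p q r : S2) (θ : ℝ) : Prop :=
  0 < θ ∧ θ < 2 * Real.pi ∧
  ∃ u e : E3, Orthonormal ℝ ![(p : E3), u, e] ∧
    (∃ a b : ℝ, 0 < b ∧ (q : E3) = a • (p : E3) + b • u) ∧
    (∃ a b : ℝ, 0 < b ∧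
      (r : E3) = a • (p : E3) + b • (Real.cos θ • u + Real.sin θ • e)) ∧
    ∀ᶠ z : S2 in nhds p,
      z ∈ R ↔ ∃ a b φ : ℝ, 0 ≤ b ∧ 0 ≤ φ ∧ φ ≤ θ ∧
        (z : E3) = a • (p : E3) + b • (Real.cos φ • u + Real.sin φ • e)

/-- A (simple, not necessarily convex) spherical polygon with `n ≥ 3` sides: a closed region of
the sphere, bounded by a simple closed curve made of `n` great-circle arcs, each shorter
than `π`. The vertices are listed in cyclic order, in one of the two directions. -/
structure SphericalPolygon (n : ℕ) where
  three_le : 3 ≤ n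
  /-- the vertices, in cyclic order; the `i`-th edge joins the vertices `i` and `i + 1` -/
  vertex : ZMod n → S2
  vertex_ne : ∀ i, vertex i ≠ vertex (i + 1)
  vertex_ne_neg : ∀ i, vertex i ≠ -vertex (i + 1)
  /-- consecutive edges meet only in their common vertex -/
  edge_inter_next : ∀ i,
    arc (vertex i) (vertex (i + 1)) ∩ arc (vertex (i + 1)) (vertex (i + 1 + 1)) = {vertex (i + 1)}
  /-- other pairs of edges are disjoint -/
  edge_disjoint : ∀ i j, i ≠ j → j ≠ i + 1 → i ≠ j + 1 →
    Disjoint (arc (vertex i) (vertex (i + 1))) (arc (vertex j) (vertex (j + 1)))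
  /-- the closed region that is bounded by the edges -/
  region : Set S2
  frontier_region : frontier region = ⋃ i, arc (vertex i) (vertex (i + 1))
  region_eq_closure : region = closure (interior region)
  interior_connected : IsConnected (interior region)
  /-- the interior angles; the next condition determines them -/
  angle : ZMod n → ℝ
  isInteriorAngle : ∀ i,
    IsInteriorAngle region (vertex i) (vertex (i + 1)) (vertex (i - 1)) (angle i)

namespace SphericalPolygon

/-- The length of the `i`-th edge. -/
noncomputable def edgeLength {n : ℕ} (P : SphericalPolygon n) (i : ZMod n) : ℝ :=
  InnerProductGeometry.angle (P.vertex i : E3) (P.vertex (i + 1) : E3)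

/-- A regular polygon: all edges have length `x` and all angles are `α`. -/
def IsRegular {n : ℕ} (P : SphericalPolygon n) (x α : ℝ) : Prop :=
  (∀ i, P.edgeLength i = x) ∧ ∀ i, P.angle i = α

/-- A quadrilateral with equal opposite edges: its edges are `x, y, x, y` in cyclic
order, with `x ≠ y`, and its angles are `β, γ, β, γ` in cyclic order. -/
def HasEqualOppositeEdges (Q : SphericalPolygon 4) (x y β γ : ℝ) : Prop :=
  x ≠ y ∧
  Q.edgeLength 0 = x ∧ Q.edgeLength 1 = y ∧ Q.edgeLength 2 = x ∧ Q.edgeLength 3 = y ∧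
  Q.angle 0 = β ∧ Q.angle 1 = γ ∧ Q.angle 2 = β ∧ Q.angle 3 = γ

/-- Congruence of polygons: an isometry of the sphere (a rotation, or a rotation followed by a
reflection) takes the region of `P` to the region of `P'` and the vertices of `P` to those
of `P'`, where the cyclic order may be shifted or reversed. -/
def Congruent {n k : ℕ} (P : SphericalPolygon n) (P' : SphericalPolygon k) : Prop :=
  ∃ (g : E3 ≃ₗᵢ[ℝ] E3) (σ : ZMod k ≃ ZMod n),
    ((∀ i, σ (i + 1) = σ i + 1) ∨ (∀ i, σ (i + 1) = σ i - 1)) ∧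
    (∀ i, (P'.vertex i : E3) = g (P.vertex (σ i))) ∧
    (∀ z : S2, z ∈ P'.region ↔ ∃ w ∈ P.region, (z : E3) = g w)

end SphericalPolygon

/-- An edge-to-edge tiling of the sphere by finitely many polygons, all of whose vertices have
degree at least three. -/
structure SphericalTiling where
  numTiles : ℕ
  sides : Fin numTiles → ℕ
  tile : ∀ j, SphericalPolygon (sides j)
  cover : ⋃ j, (tile j).region = Set.univ
  disjoint_interior : Pairwise fun j k =>
    Disjoint (interior (tile j).region) (interior (tile k).region)
  /-- a vertex of a tile that lies in another tile is a vertex of that tile too -/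
  edge_to_edge : ∀ j i k, (tile j).vertex i ∈ (tile k).region →
    ∃ l, (tile k).vertex l = (tile j).vertex i
  /-- the degree of a vertex is the number of corners of tiles that meet there -/
  three_le_degree : ∀ j i,
    3 ≤ {c : Σ k, ZMod (sides k) | (tile c.1).vertex c.2 = (tile j).vertex i}.ncard

namespace SphericalTiling

/-- The corners of tiles that meet at the point `v`. A corner is a tile together with the index
of one of its vertices. -/
def cornersAt (T : SphericalTiling) (v : S2) : Set (Σ k, ZMod (T.sides k)) :=
  {c | (T.tile c.1).vertex c.2 = v}

/-- A dihedral tiling with prototiles `P` and `Q`: each tile is congruent to one of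
them, and both of them occur. -/
def IsDihedral (T : SphericalTiling) {n k : ℕ} (P : SphericalPolygon n)
    (Q : SphericalPolygon k) : Prop :=
  (∀ j, P.Congruent (T.tile j) ∨ Q.Congruent (T.tile j)) ∧
  (∃ j, P.Congruent (T.tile j)) ∧ (∃ j, Q.Congruent (T.tile j))

/-- `T` has a vertex of type `α^a β^b γ^c`: there meet exactly `a` corners of tiles congruent
to `P`, and, of tiles congruent to `Q`, exactly `b` corners of angle `β` and exactly `c`
corners of angle `γ`. -/
def HasVertexOfType (T : SphericalTiling) {n k : ℕ} (P : SphericalPolygon n)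
    (Q : SphericalPolygon k) (β γ : ℝ) (a b c : ℕ) : Prop :=
  ∃ v : S2, (T.cornersAt v).Nonempty ∧
    {s ∈ T.cornersAt v | P.Congruent (T.tile s.1)}.ncard = a ∧
    {s ∈ T.cornersAt v | Q.Congruent (T.tile s.1) ∧ (T.tile s.1).angle s.2 = β}.ncard = b ∧
    {s ∈ T.cornersAt v | Q.Congruent (T.tile s.1) ∧ (T.tile s.1).angle s.2 = γ}.ncard = c

end SphericalTiling

/-!
In a small frame at a vertex, the corners that meet there are sectors, which correspond to arcs
that tile the circle of directions. Hence their angles add up to `2π`, they are cyclically ordered,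
and neighbouring corners share an edge. At every corner of a copy of `Q` exactly one side has
length `y`, so these corners come in pairs and their number at a vertex is even.

A vertex of type `αβ²` gives `α + 2β = 2π`, so `β` and `γ` are less than `π`, a diagonal cuts `Q`
into two spherical triangles, and `β + γ > π`. The vertices of `P` run once around a circle, which
gives `mα > (m - 2)π`, so `2α > π`. These inequalities leave the vertex types `αβ²`, `α³`, `α²γ²`,
`αγ⁴`, and types without `α` that have fewer angles `β` than `γ`.

The edges of a copy of `P` at a vertex of type `αβ²` are shared with copies of `Q`, so the next
vertex has an angle `γ`.
* If its type is `α²γ²`, then `m < 6`, and all vertices of this copy of `P` have type `αβ²` or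
  `α²γ²`. Around the copy, the types have period three, which is impossible for `m = 4, 5`.
* If its type is `αγ⁴`, then every vertex with an `α` has type `αβ²` or `αγ⁴`, with an excess of
  angles `β` over angles `γ` of `2` or `-4`. Two consecutive vertices of a copy of `P` do not both
  have type `αβ²`, so the excesses have a negative sum over the corners of copies of `P`; but `β`
  and `γ` occur equally often in the tiling.
-/

open scoped RealInnerProductSpace Real Topology

/-! ### Vector algebra in three-space -/

/-- The vector product on `E3`, as a bilinear map. -/
noncomputable def cross3 : E3 →ₗ[ℝ] E3 →ₗ[ℝ] E3 :=
  (crossProduct.compl₁₂ (WithLp.linearEquiv 2 ℝ (Fin 3 → ℝ)).toLinearMap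
    (WithLp.linearEquiv 2 ℝ (Fin 3 → ℝ)).toLinearMap).compr₂
    (WithLp.linearEquiv 2 ℝ (Fin 3 → ℝ)).symm.toLinearMap

/-- The triple product; it is positive when `a, b, c` is a right-handed basis. -/
noncomputable def det3 (a b c : E3) : ℝ := ⟪cross3 a b, c⟫

theorem inner_eq_dotProduct (a b : E3) : ⟪a, b⟫ = a.ofLp ⬝ᵥ b.ofLp := by
  rw [EuclideanSpace.inner_eq_star_dotProduct, star_trivial, dotProduct_comm]

theorem ofLp_cross3 (a b : E3) : (cross3 a b).ofLp = crossProduct a.ofLp b.ofLp := rfl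

theorem inner_cross3_cross3 (a b c d : E3) :
    ⟪cross3 a b, cross3 c d⟫ = ⟪a, c⟫ * ⟪b, d⟫ - ⟪a, d⟫ * ⟪b, c⟫ := by
  simp only [inner_eq_dotProduct, ofLp_cross3, cross_dot_cross]

theorem inner_cross3_left (a b : E3) : ⟪a, cross3 a b⟫ = 0 := by
  simp only [inner_eq_dotProduct, ofLp_cross3, dot_self_cross]

theorem inner_cross3_right (a b : E3) : ⟪b, cross3 a b⟫ = 0 := by
  simp only [inner_eq_dotProduct, ofLp_cross3, dot_cross_self]

theorem cross3_swap (a b : E3) : cross3 b a = -cross3 a b :=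
  WithLp.ofLp_injective 2 (cross_anticomm _ _).symm

theorem cross3_self (a : E3) : cross3 a a = 0 :=
  WithLp.ofLp_injective 2 (_root_.cross_self _)

theorem det3_cyclic (a b c : E3) : det3 a b c = det3 b c a := by
  simp only [det3, real_inner_comm _ (cross3 _ _), inner_eq_dotProduct, ofLp_cross3,
    triple_product_permutation c.ofLp]

theorem cross3_cross3 (a b c : E3) : cross3 a (cross3 b c) = ⟪a, c⟫ • b - ⟪a, b⟫ • c := by
  rw [inner_eq_dotProduct, inner_eq_dotProduct, dotProduct_comm a.ofLp b.ofLp]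
  exact WithLp.ofLp_injective 2 (cross_cross_eq_smul_sub_smul' a.ofLp b.ofLp c.ofLp)

theorem S2.inner_self (p : S2) : ⟪(p : E3), (p : E3)⟫ = 1 := by
  rw [real_inner_self_eq_norm_sq, norm_eq_of_mem_sphere, one_pow]

/-! ### Orthonormal frames and polar coordinates -/

/-- An orthonormal basis `p, u, e` of three-space; `(u, e)` is used as a basis of the tangent
plane of the sphere at `p`. -/
structure Frame (p u e : E3) : Prop where
  pp : ⟪p, p⟫ = 1
  uu : ⟪u, u⟫ = 1
  ee : ⟪e, e⟫ = 1
  pu : ⟪p, u⟫ = 0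
  pe : ⟪p, e⟫ = 0
  ue : ⟪u, e⟫ = 0

/-- The unit vector at angle `φ` from `u` in the plane with orthonormal basis `(u, e)`. -/
noncomputable def dir (u e : E3) (φ : Real.Angle) : E3 := φ.cos • u + φ.sin • e

theorem dir_zero (u e : E3) : dir u e 0 = u := by simp [dir]

theorem dir_coe (u e : E3) (φ : ℝ) : dir u e φ = Real.cos φ • u + Real.sin φ • e := rfl

theorem dir_add (u e : E3) (φ ψ : Real.Angle) :
    dir u e (φ + ψ) = ψ.cos • dir u e φ + ψ.sin • dir u e (φ + (π / 2 : ℝ)) := by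
  simp only [dir, Real.Angle.cos_add, Real.Angle.sin_add, Real.Angle.cos_coe, Real.Angle.sin_coe,
    Real.cos_pi_div_two, Real.sin_pi_div_two]
  module

theorem dir_add_pi (u e : E3) (φ : Real.Angle) : dir u e (φ + π) = -dir u e φ := by
  simp only [dir, Real.Angle.cos_add_pi, Real.Angle.sin_add_pi]
  module

theorem exists_angle_of_sq_add_sq {x y : ℝ} (h : x ^ 2 + y ^ 2 = 1) :
    ∃ φ : Real.Angle, φ.cos = x ∧ φ.sin = y := by
  have hz : ‖(⟨x, y⟩ : ℂ)‖ = 1 := by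
    rw [← sq_eq_sq₀ (norm_nonneg _) zero_le_one, Complex.sq_norm, Complex.normSq_mk]
    linarith
  obtain ⟨θ, hθ⟩ := Complex.norm_eq_one_iff _ |>.1 hz
  exact ⟨θ, by simpa [Complex.exp_ofReal_mul_I_re] using congrArg Complex.re hθ,
    by simpa [Complex.exp_ofReal_mul_I_im] using congrArg Complex.im hθ⟩

namespace Frame

variable {p u e : E3}

theorem up (h : Frame p u e) : ⟪u, p⟫ = 0 := by rw [real_inner_comm, h.pu]

theorem ep (h : Frame p u e) : ⟪e, p⟫ = 0 := by rw [real_inner_comm, h.pe]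

theorem eu (h : Frame p u e) : ⟪e, u⟫ = 0 := by rw [real_inner_comm, h.ue]

theorem orthonormal (h : Frame p u e) : Orthonormal ℝ ![p, u, e] := by
  rw [orthonormal_iff_ite]
  intro i j
  fin_cases i <;> fin_cases j <;>
    simp [-inner_self_eq_norm_sq_to_K, h.pp, h.uu, h.ee, h.pu, h.pe, h.ue, h.up, h.ep, h.eu]

theorem of_orthonormal (h : Orthonormal ℝ ![p, u, e]) : Frame p u e := by
  rw [orthonormal_iff_ite] at h
  exact ⟨by simpa using h 0 0, by simpa using h 1 1, by simpa using h 2 2,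
    by simpa using h 0 1, by simpa using h 0 2, by simpa using h 1 2⟩

theorem of_cross3 (hp : ⟪p, p⟫ = 1) (hu : ⟪u, u⟫ = 1) (hpu : ⟪p, u⟫ = 0) :
    Frame p u (cross3 p u) :=
  ⟨hp, hu, by rw [inner_cross3_cross3, hp, hu, hpu]; norm_num, hpu, inner_cross3_left _ _,
    inner_cross3_right _ _⟩

theorem expand (h : Frame p u e) (w : E3) : w = ⟪p, w⟫ • p + ⟪u, w⟫ • u + ⟪e, w⟫ • e := by
  let B := basisOfOrthonormalOfCardEqFinrank h.orthonormal (by simp)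
  have hB : (B : Fin 3 → E3) = ![p, u, e] := coe_basisOfOrthonormalOfCardEqFinrank _ _
  have hsum := (B.toOrthonormalBasis (hB ▸ h.orthonormal)).sum_repr' w
  simp only [Module.Basis.coe_toOrthonormalBasis, hB, Fin.sum_univ_three] at hsum
  exact hsum.symm

theorem cross3_eq_smul (h : Frame p u e) :
    ∃ s : ℝ, (s = 1 ∨ s = -1) ∧ cross3 p u = s • e := by
  have hcross : cross3 p u = ⟪e, cross3 p u⟫ • e := by
    have hexp := h.expand (cross3 p u)
    rwa [inner_cross3_left, inner_cross3_right, zero_smul, zero_smul, zero_add, zero_add] at hexp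
  have hn := inner_cross3_cross3 p u p u
  rw [h.pp, h.uu, h.pu, h.up, hcross, inner_smul_left, inner_smul_right, h.ee, mul_one, mul_one,
    mul_zero, sub_zero] at hn
  exact ⟨_, mul_self_eq_one_iff.1 hn, hcross⟩

theorem inner_dir (h : Frame p u e) (φ : Real.Angle) : ⟪p, dir u e φ⟫ = 0 := by
  simp [dir, inner_add_right, inner_smul_right, h.pu, h.pe]

theorem inner_dir_dir (h : Frame p u e) (φ ψ : Real.Angle) :
    ⟪dir u e φ, dir u e ψ⟫ = (φ - ψ).cos := by
  simp only [dir, inner_add_right, inner_add_left, inner_smul_right, inner_smul_left, h.uu, h.ee,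
    h.ue, h.eu, RCLike.conj_to_real, sub_eq_add_neg, Real.Angle.cos_add, Real.Angle.cos_neg,
    Real.Angle.sin_neg]
  ring

theorem inner_dir_self (h : Frame p u e) (φ : Real.Angle) : ⟪dir u e φ, dir u e φ⟫ = 1 := by
  rw [h.inner_dir_dir, sub_self, Real.Angle.cos_zero]

theorem exists_dir_eq (h : Frame p u e) {w : E3} (hpw : ⟪p, w⟫ = 0) (hw : ⟪w, w⟫ = 1) :
    ∃ φ, w = dir u e φ := by
  have hexp := h.expand w
  rw [hpw, zero_smul, zero_add] at hexp
  have hsq : ⟪u, w⟫ ^ 2 + ⟪e, w⟫ ^ 2 = 1 := by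
    rw [hexp] at hw
    simp only [inner_add_right, inner_add_left, inner_smul_right, inner_smul_left, h.uu, h.ee,
      h.ue, h.eu, RCLike.conj_to_real] at hw
    linarith
  obtain ⟨φ, hcos, hsin⟩ := exists_angle_of_sq_add_sq hsq
  exact ⟨φ, by rw [dir, hcos, hsin, ← hexp]⟩

theorem dir_injective (h : Frame p u e) : Function.Injective (dir u e) := by
  intro φ ψ hd
  have hcos : (φ - ψ).cos = 1 := by rw [← h.inner_dir_dir, hd, h.inner_dir_self]
  have hzero := Real.Angle.cos_eq_iff_eq_or_eq_neg.1 (hcos.trans Real.Angle.cos_zero.symm)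
  rw [neg_zero, or_self] at hzero
  exact sub_eq_zero.1 hzero

theorem polar_inj (h : Frame p u e) {a b a' b' : ℝ} {φ ψ : Real.Angle} (hb : 0 < b)
    (hb' : 0 ≤ b') (heq : a • p + b • dir u e φ = a' • p + b' • dir u e ψ) :
    a = a' ∧ b = b' ∧ φ = ψ := by
  have ha : a = a' := by
    simpa only [inner_add_right, inner_smul_right, h.pp, h.inner_dir, mul_one, mul_zero,
      add_zero] using congrArg (fun w => ⟪p, w⟫) heq
  subst ha
  have hdir := add_left_cancel heq
  have hbb : b = b' := by
    have hsq := congrArg (fun w => ⟪w, w⟫) hdir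
    simp only [inner_smul_left, inner_smul_right, h.inner_dir_self, RCLike.conj_to_real] at hsq
    nlinarith
  subst hbb
  exact ⟨rfl, rfl, h.dir_injective (smul_right_injective _ hb.ne' hdir)⟩

theorem change (h : Frame p u e) {u' e' : E3} (h' : Frame p u' e') :
    ∃ A : Real.Angle, (∀ φ, dir u' e' φ = dir u e (A + φ)) ∨
      ∀ φ, dir u' e' φ = dir u e (A - φ) := by
  obtain ⟨A, rfl⟩ := h.exists_dir_eq h'.pu h'.uu
  obtain ⟨B, rfl⟩ := h.exists_dir_eq h'.pe h'.ee
  have hperp : B - A = (π / 2 : ℝ) ∨ B - A = (-π / 2 : ℝ) :=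
    Real.Angle.cos_eq_zero_iff.1 (by rw [← h.inner_dir_dir, h'.eu])
  refine ⟨A, hperp.imp (fun hAB φ => ?_) (fun hAB φ => ?_)⟩
  · rw [dir_add u e A, dir, ← eq_add_of_sub_eq' hAB]
  · have hneg : ((-π / 2 : ℝ) : Real.Angle) = (π / 2 : ℝ) + π :=
      Real.Angle.angle_eq_iff_two_pi_dvd_sub.2 ⟨-1, by push_cast; ring⟩
    rw [sub_eq_add_neg, dir_add u e A, Real.Angle.cos_neg, Real.Angle.sin_neg, dir,
      eq_add_of_sub_eq' hAB, hneg, ← add_assoc, dir_add_pi, smul_neg, neg_smul]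

end Frame

/-! ### Tilings of the circle by arcs -/

theorem coe_angle_ne_zero {t : ℝ} (h0 : 0 < t) (h1 : t < 2 * π) : (t : Real.Angle) ≠ 0 := by
  intro h
  obtain ⟨k, hk⟩ := Real.Angle.angle_eq_iff_two_pi_dvd_sub.1 (h.trans Real.Angle.coe_zero.symm)
  have hk0 : (0 : ℝ) < k := by nlinarith [Real.pi_pos]
  have hk1 : (k : ℝ) < 1 := by nlinarith [Real.pi_pos]
  norm_cast at hk0 hk1
  omega

theorem eq_two_pi_of_coe_angle_eq_zero {t : ℝ} (h0 : 0 < t) (h1 : t < 2 * π + 2 * π)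
    (ht : (t : Real.Angle) = 0) : t = 2 * π := by
  rcases lt_trichotomy t (2 * π) with hlt | heq | hgt
  · exact absurd ht (coe_angle_ne_zero h0 hlt)
  · exact heq
  · refine absurd ?_ (coe_angle_ne_zero (t := t - 2 * π) (by linarith) (by linarith))
    rw [Real.Angle.coe_sub, ht, Real.Angle.coe_two_pi, sub_zero]

local instance fact_two_pi_pos : Fact (0 < 2 * π) := ⟨Real.two_pi_pos⟩

/-- The closed arc of length `θ` that starts at `A`, in the positive direction of the circle. -/
def circleArc (A : Real.Angle) (θ : ℝ) : Set Real.Angle := (fun t : ℝ => A + t) '' Set.Icc 0 θ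

section CircleArc

variable {A : Real.Angle} {θ : ℝ}

theorem add_coe_mem_circleArc {t : ℝ} (h0 : 0 ≤ t) (h1 : t ≤ θ) : A + t ∈ circleArc A θ :=
  ⟨t, ⟨h0, h1⟩, rfl⟩

theorem left_mem_circleArc (hθ : 0 ≤ θ) : A ∈ circleArc A θ := by
  simpa using add_coe_mem_circleArc (A := A) le_rfl hθ

theorem right_mem_circleArc (hθ : 0 ≤ θ) : A + θ ∈ circleArc A θ :=
  add_coe_mem_circleArc hθ le_rfl

theorem add_coe_notMem_circleArc {t : ℝ} (h0 : θ < t) (h1 : t < 2 * π) :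
    A + t ∉ circleArc A θ := by
  rintro ⟨s, ⟨hs0, hsθ⟩, hs⟩
  refine coe_angle_ne_zero (t := t - s) (by linarith) (by linarith) ?_
  rw [Real.Angle.coe_sub, ← add_left_cancel hs, sub_self]

theorem isClosed_circleArc (A : Real.Angle) (θ : ℝ) : IsClosed (circleArc A θ) :=
  (isCompact_Icc.image (continuous_const.add Real.Angle.continuous_coe)).isClosed

theorem add_mem_circleArc {B ψ : Real.Angle} :
    B + ψ ∈ circleArc A θ ↔ ψ ∈ circleArc (A - B) θ := by
  simp only [circleArc, Set.mem_image, sub_add_eq_add_sub, sub_eq_iff_eq_add']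

theorem sub_mem_circleArc {B ψ : Real.Angle} :
    B - ψ ∈ circleArc A θ ↔ ψ ∈ circleArc (B - A - θ) θ := by
  have reverse {t : ℝ} : A + t = B - ψ ↔ B - A - θ + (θ - t : ℝ) = ψ := by
    rw [Real.Angle.coe_sub, sub_add_sub_cancel, sub_sub, eq_sub_iff_add_eq, sub_eq_iff_eq_add,
      add_comm ψ, eq_comm]
  constructor
  · rintro ⟨t, ⟨h0, h1⟩, ht⟩
    exact ⟨θ - t, ⟨sub_nonneg.2 h1, by linarith⟩, reverse.1 ht⟩
  · rintro ⟨t, ⟨h0, h1⟩, ht⟩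
    exact ⟨θ - t, ⟨sub_nonneg.2 h1, by linarith⟩, reverse.2 (by simpa using ht)⟩

theorem circleArc_eq_closedBall (A : Real.Angle) (θ : ℝ) :
    circleArc A θ = Metric.closedBall (A + (θ / 2 : ℝ)) (θ / 2) := by
  induction A using Real.Angle.induction_on with | h a
  ext ψ
  induction ψ using Real.Angle.induction_on with | h x
  have hball := Set.ext_iff.1
    (AddCircle.coe_real_preimage_closedBall_eq_iUnion (p := 2 * π) (a + θ / 2) (θ / 2)) x
  refine Iff.trans ?_ hball.symm
  simp only [circleArc, Set.mem_image, Set.mem_Icc, ← Real.Angle.coe_add,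
    Real.Angle.angle_eq_iff_two_pi_dvd_sub, Set.mem_iUnion, Real.closedBall_eq_Icc, zsmul_eq_mul]
  constructor
  · rintro ⟨t, ⟨h0, h1⟩, k, hk⟩
    exact ⟨-k, by push_cast; linarith, by push_cast; linarith⟩
  · rintro ⟨k, h0, h1⟩
    exact ⟨x - a - k * (2 * π), ⟨by linarith, by linarith⟩, -k, by push_cast; ring⟩

theorem volume_circleArc (A : Real.Angle) (hθ : θ ≤ 2 * π) :
    (MeasureTheory.volume : MeasureTheory.Measure (AddCircle (2 * π))) (circleArc A θ) =
      ENNReal.ofReal θ := by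
  rw [circleArc_eq_closedBall]
  exact (AddCircle.volume_closedBall _ _).trans
    (by rw [mul_div_cancel₀ _ two_ne_zero, min_eq_right hθ])

theorem length_eq_of_circleArc_eq {B : Real.Angle} {θ' : ℝ} (hθ : 0 ≤ θ) (hθ' : 0 ≤ θ')
    (hlt : θ ≤ 2 * π) (hlt' : θ' ≤ 2 * π) (h : circleArc A θ = circleArc B θ') : θ = θ' := by
  rw [← ENNReal.ofReal_eq_ofReal_iff hθ hθ', ← volume_circleArc A hlt, h, volume_circleArc B hlt']

end CircleArc

/-- A family of arcs `[A c, A c + θ c]` that covers the circle, where different arcs meet in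
end points only. -/
structure CircleTiling {ι : Type*} (A : ι → Real.Angle) (θ : ι → ℝ) : Prop where
  pos : ∀ c, 0 < θ c
  lt : ∀ c, θ c < 2 * π
  cover : ∀ ψ, ∃ c, ψ ∈ circleArc (A c) (θ c)
  overlap : ∀ c c' ψ, c ≠ c' → ψ ∈ circleArc (A c) (θ c) → ψ ∈ circleArc (A c') (θ c') →
    ψ = A c ∨ ψ = A c + θ c

namespace CircleTiling

variable {ι : Type*} {A : ι → Real.Angle} {θ : ι → ℝ}

theorem notMem_of_interior (h : CircleTiling A θ) {c c' : ι} (hne : c ≠ c') {t : ℝ}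
    (h0 : 0 < t) (h1 : t < θ c) : A c + t ∉ circleArc (A c') (θ c') := by
  intro hmem
  rcases h.overlap c c' _ hne (add_coe_mem_circleArc h0.le h1.le) hmem with hA | hA
  · exact coe_angle_ne_zero h0 (h1.trans (h.lt c)) (add_eq_left.1 hA)
  · refine coe_angle_ne_zero (sub_pos.2 h1) (by linarith [h.lt c]) ?_
    rw [Real.Angle.coe_sub, ← add_left_cancel hA, sub_self]

theorem start_injective (h : CircleTiling A θ) : Function.Injective A := by
  intro c c' hc
  by_contra hne
  obtain ⟨ε, h0, h1⟩ := exists_between (lt_min (h.pos c) (h.pos c'))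
  obtain ⟨h2, h3⟩ := lt_min_iff.1 h1
  exact h.notMem_of_interior hne h0 h2 (hc ▸ add_coe_mem_circleArc h0.le h3.le)

theorem end_injective (h : CircleTiling A θ) : Function.Injective fun c => A c + θ c := by
  intro c c' hc
  by_contra hne
  obtain ⟨ε, h0, h1⟩ := exists_between (lt_min (h.pos c) (h.pos c'))
  obtain ⟨h2, h3⟩ := lt_min_iff.1 h1
  refine h.notMem_of_interior hne (t := θ c - ε) (by linarith) (by linarith) ?_
  have hend : A c + (θ c - ε : ℝ) = A c' + (θ c' - ε : ℝ) := by
    rw [Real.Angle.coe_sub, Real.Angle.coe_sub, ← add_sub_assoc, ← add_sub_assoc]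
    exact congrArg (· - (ε : Real.Angle)) hc
  rw [hend]
  exact add_coe_mem_circleArc (by linarith) (by linarith)

theorem exists_next [Finite ι] (h : CircleTiling A θ) (c : ι) : ∃ c', A c' = A c + θ c := by
  have hclosed : IsClosed (⋃ c' ∈ {c' | c' ≠ c}, circleArc (A c') (θ c')) :=
    (Set.toFinite _).isClosed_biUnion fun c' _ => isClosed_circleArc _ _
  have hlim : Filter.Tendsto (fun t : ℝ => A c + t) (𝓝[>] θ c) (𝓝 (A c + θ c)) :=
    ((continuous_const.add Real.Angle.continuous_coe).tendsto _).mono_left nhdsWithin_le_nhds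
  have hmem : ∀ᶠ t : ℝ in 𝓝[>] θ c, A c + t ∈ ⋃ c' ∈ {c' | c' ≠ c}, circleArc (A c') (θ c') := by
    filter_upwards [Ioo_mem_nhdsGT (h.lt c)] with t ht
    obtain ⟨c', hc'⟩ := h.cover (A c + t)
    refine Set.mem_biUnion (x := c') ?_ hc'
    rintro rfl
    exact add_coe_notMem_circleArc ht.1 ht.2 hc'
  obtain ⟨c', hne, hc'⟩ := Set.mem_iUnion₂.1 (hclosed.mem_of_tendsto hlim hmem)
  refine ⟨c', ?_⟩
  rcases h.overlap c' c _ hne hc' (right_mem_circleArc (h.pos c).le) with hA | hA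
  · exact hA.symm
  · exact absurd (h.end_injective hA).symm hne

theorem sum_eq [Fintype ι] (h : CircleTiling A θ) : ∑ c, θ c = 2 * π := by
  let S (c : ι) : Set (AddCircle (2 * π)) := circleArc (A c) (θ c)
  have hvol (c : ι) : MeasureTheory.volume (S c) = ENNReal.ofReal (θ c) :=
    volume_circleArc _ (h.lt c).le
  have hpoint (ψ : Real.Angle) :
      (MeasureTheory.volume : MeasureTheory.Measure (AddCircle (2 * π))) (circleArc ψ 0) = 0 := by
    rw [volume_circleArc ψ Real.two_pi_pos.le, ENNReal.ofReal_zero]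
  have hcover : ⋃ c, S c = Set.univ :=
    Set.eq_univ_of_forall fun ψ => Set.mem_iUnion.2 (h.cover ψ)
  have hdisj : Pairwise (Function.onFun (MeasureTheory.AEDisjoint MeasureTheory.volume) S) := by
    intro c c' hne
    refine MeasureTheory.measure_mono_null ?_
      (MeasureTheory.measure_union_null (hpoint (A c)) (hpoint (A c + θ c)))
    rintro ψ ⟨hc, hc'⟩
    rcases h.overlap c c' ψ hne hc hc' with rfl | rfl
    · exact Or.inl (left_mem_circleArc le_rfl)
    · exact Or.inr (left_mem_circleArc le_rfl)
  have hclosed (c : ι) : IsClosed (S c) := isClosed_circleArc (A c) (θ c)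
  have hsum := MeasureTheory.measure_iUnion₀ hdisj
    fun c => (hclosed c).measurableSet.nullMeasurableSet
  rw [hcover, AddCircle.measure_univ, tsum_fintype] at hsum
  simp only [hvol] at hsum
  rw [← ENNReal.ofReal_sum_of_nonneg fun c _ => (h.pos c).le] at hsum
  exact ((ENNReal.ofReal_eq_ofReal_iff Real.two_pi_pos.le
    (Finset.sum_nonneg fun c _ => (h.pos c).le)).1 hsum).symm

theorem add_eq_of_mutual (h : CircleTiling A θ) {c c' : ι} (h1 : A c' = A c + θ c)
    (h2 : A c = A c' + θ c') : θ c + θ c' = 2 * π := by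
  refine eq_two_pi_of_coe_angle_eq_zero (add_pos (h.pos c) (h.pos c'))
    (add_lt_add (h.lt c) (h.lt c')) ?_
  rw [h1, add_assoc, left_eq_add] at h2
  rwa [Real.Angle.coe_add]

end CircleTiling

/-! ### Sectors and interior angles -/

/-- The region `R` consists, near `p`, of the points that are seen from `p` in a direction in
`S`, where directions are measured in the frame `(u, e)`. The point `p` itself is left open. -/
def IsSector (R : Set S2) (p : S2) (u e : E3) (S : Set Real.Angle) : Prop :=
  ∀ᶠ z : S2 in 𝓝 p, ∀ (a b : ℝ) (ψ : Real.Angle), 0 < b →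
    (z : E3) = a • (p : E3) + b • dir u e ψ → (z ∈ R ↔ ψ ∈ S)

/-- The point `q` is seen from `p` in the direction `w`. -/
def Sees (p q : S2) (w : E3) : Prop := ∃ a b : ℝ, 0 < b ∧ (q : E3) = a • (p : E3) + b • w

theorem Sees.angle_eq {p q : S2} {u e : E3} {φ ψ : Real.Angle} (h : Frame (p : E3) u e)
    (hφ : Sees p q (dir u e φ)) (hψ : Sees p q (dir u e ψ)) : φ = ψ := by
  obtain ⟨a, b, hb, hq⟩ := hφ
  obtain ⟨a', b', hb', hq'⟩ := hψ
  exact (h.polar_inj hb hb'.le (hq.symm.trans hq')).2.2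

namespace Frame

variable {p : S2} {u e : E3}

theorem norm_cos_smul_add_sin_smul (h : Frame (p : E3) u e) (ψ : Real.Angle) (t : ℝ) :
    ‖Real.cos t • (p : E3) + Real.sin t • dir u e ψ‖ = 1 := by
  rw [← sq_eq_sq₀ (norm_nonneg _) zero_le_one, norm_add_sq_real, norm_smul, norm_smul,
    inner_smul_left, inner_smul_right, h.inner_dir, norm_eq_of_mem_sphere, mul_pow, mul_pow,
    ← real_inner_self_eq_norm_sq (dir u e ψ), h.inner_dir_self, Real.norm_eq_abs,
    Real.norm_eq_abs, sq_abs, sq_abs]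
  linarith [Real.sin_sq_add_cos_sq t]

/-- The point at distance `t` from `p` in the direction `ψ`. -/
noncomputable def polar (h : Frame (p : E3) u e) (ψ : Real.Angle) (t : ℝ) : S2 :=
  ⟨Real.cos t • (p : E3) + Real.sin t • dir u e ψ,
    mem_sphere_zero_iff_norm.2 (h.norm_cos_smul_add_sin_smul ψ t)⟩

theorem coe_polar (h : Frame (p : E3) u e) (ψ : Real.Angle) (t : ℝ) :
    (h.polar ψ t : E3) = Real.cos t • (p : E3) + Real.sin t • dir u e ψ := rfl

theorem tendsto_polar (h : Frame (p : E3) u e) (ψ : Real.Angle) :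
    Filter.Tendsto (h.polar ψ) (𝓝[>] 0) (𝓝 p) := by
  have hcont : Continuous (h.polar ψ) := Continuous.subtype_mk (by fun_prop) _
  have hzero : h.polar ψ 0 = p := Subtype.ext (by simp [coe_polar])
  have hlim := hcont.tendsto 0
  rw [hzero] at hlim
  exact hlim.mono_left nhdsWithin_le_nhds

end Frame

theorem eventually_sin_pos : ∀ᶠ t : ℝ in 𝓝[>] 0, 0 < Real.sin t := by
  filter_upwards [Ioo_mem_nhdsGT Real.pi_pos] with t ht
  exact Real.sin_pos_of_pos_of_lt_pi ht.1 ht.2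

namespace IsSector

variable {R : Set S2} {p : S2} {u e u' e' : E3} {S S' : Set Real.Angle}

theorem eventually_polar (hs : IsSector R p u e S) (h : Frame (p : E3) u e) (ψ : Real.Angle) :
    ∀ᶠ t in 𝓝[>] 0, h.polar ψ t ∈ R ↔ ψ ∈ S := by
  filter_upwards [(h.tendsto_polar ψ).eventually hs, eventually_sin_pos] with t ht hsin
  exact ht _ _ _ hsin (h.coe_polar ψ t)

theorem unique (h : Frame (p : E3) u e) (hs : IsSector R p u e S) (hs' : IsSector R p u e S') :
    S = S' := by
  ext ψ
  obtain ⟨t, ht, ht'⟩ := ((hs.eventually_polar h ψ).and (hs'.eventually_polar h ψ)).exists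
  exact ht.symm.trans ht'

theorem change (hs : IsSector R p u' e' S) (f : Real.Angle → Real.Angle)
    (hf : ∀ ψ, dir u e ψ = dir u' e' (f ψ)) : IsSector R p u e (f ⁻¹' S) :=
  hs.mono fun _ hz a b ψ hb hzz => hz a b (f ψ) hb (hf ψ ▸ hzz)

end IsSector

namespace IsInteriorAngle

variable {R : Set S2} {p q r q' r' : S2} {θ θ' : ℝ} {u e : E3}

theorem exists_frame (h : IsInteriorAngle R p q r θ) :
    ∃ u e : E3, Frame (p : E3) u e ∧ Sees p q (dir u e 0) ∧ Sees p r (dir u e θ) ∧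
      IsSector R p u e (circleArc 0 θ) := by
  obtain ⟨-, -, u, e, ho, hq, hr, hz⟩ := h
  have hf := Frame.of_orthonormal ho
  refine ⟨u, e, hf, by rwa [dir_zero], hr, ?_⟩
  refine hz.mono fun z hz a b ψ hb hzz => hz.trans ?_
  constructor
  · rintro ⟨a', b', φ, hb', h0, h1, hzφ⟩
    obtain ⟨-, -, rfl⟩ := hf.polar_inj hb hb' (hzz.symm.trans (dir_coe u e φ ▸ hzφ))
    exact ⟨φ, ⟨h0, h1⟩, zero_add _⟩
  · rintro ⟨φ, ⟨h0, h1⟩, rfl⟩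
    simp only [zero_add] at hzz
    exact ⟨a, b, φ, hb.le, h0, h1, hzz⟩

theorem exists_arc (h : IsInteriorAngle R p q r θ) (hf : Frame (p : E3) u e) :
    ∃ A : Real.Angle, IsSector R p u e (circleArc A θ) ∧
      ((Sees p q (dir u e A) ∧ Sees p r (dir u e (A + θ))) ∨
        (Sees p r (dir u e A) ∧ Sees p q (dir u e (A + θ)))) := by
  obtain ⟨u', e', hf', hq, hr, hs⟩ := h.exists_frame
  obtain ⟨B, hB | hB⟩ := hf.change hf'
  · have hsector := hs.change (u := u) (e := e) (fun ψ => -B + ψ) fun ψ => by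
      rw [hB, add_neg_cancel_left]
    simp only [Set.preimage, add_mem_circleArc, zero_sub, neg_neg, Set.ofPred_mem_eq] at hsector
    rw [hB, add_zero] at hq
    exact ⟨B, hsector, Or.inl ⟨hq, hB θ ▸ hr⟩⟩
  · have hsector := hs.change (u := u) (e := e) (fun ψ => B - ψ) fun ψ => by
      rw [hB, sub_sub_cancel]
    simp only [Set.preimage, sub_mem_circleArc, sub_zero, Set.ofPred_mem_eq] at hsector
    rw [hB, sub_zero] at hq
    exact ⟨B - θ, hsector, Or.inr ⟨hB θ ▸ hr, by rwa [sub_add_cancel]⟩⟩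

theorem unique (h : IsInteriorAngle R p q r θ) (h' : IsInteriorAngle R p q' r' θ') : θ = θ' := by
  obtain ⟨u, e, hf, -, -, hs⟩ := h.exists_frame
  obtain ⟨A, hs', -⟩ := h'.exists_arc hf
  exact length_eq_of_circleArc_eq h.1.le h'.1.le h.2.1.le h'.2.1.le (hs.unique hf hs')

end IsInteriorAngle

/-! ### Congruent polygons have equal sides and angles -/

/-- The action of a linear isometry on the sphere. -/
noncomputable def sphereMap (g : E3 ≃ₗᵢ[ℝ] E3) (z : S2) : S2 :=
  ⟨g z, by rw [mem_sphere_zero_iff_norm, g.norm_map, norm_eq_of_mem_sphere]⟩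

theorem continuous_sphereMap (g : E3 ≃ₗᵢ[ℝ] E3) : Continuous (sphereMap g) :=
  (g.continuous.comp continuous_subtype_val).subtype_mk _

theorem coe_sphereMap_symm_eq_iff {g : E3 ≃ₗᵢ[ℝ] E3} {z : S2} {w : E3} :
    (sphereMap g.symm z : E3) = w ↔ (z : E3) = g w :=
  g.toLinearEquiv.symm_apply_eq

theorem sphereMap_symm_mem_iff {g : E3 ≃ₗᵢ[ℝ] E3} {R : Set S2} {z : S2} :
    sphereMap g.symm z ∈ R ↔ ∃ w ∈ R, (z : E3) = g w := by
  simp only [← coe_sphereMap_symm_eq_iff, Subtype.coe_inj, exists_eq_right']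

theorem IsInteriorAngle.map {R R' : Set S2} {p q r p' : S2} {θ : ℝ} (g : E3 ≃ₗᵢ[ℝ] E3)
    (hp : (p' : E3) = g p) (hR : ∀ z : S2, z ∈ R' ↔ ∃ w ∈ R, (z : E3) = g w)
    (h : IsInteriorAngle R p q r θ) :
    IsInteriorAngle R' p' (sphereMap g q) (sphereMap g r) θ := by
  obtain ⟨h0, h1, u, e, ho, ⟨a, b, hb, hq⟩, ⟨a', b', hb', hr⟩, hz⟩ := h
  refine ⟨h0, h1, g u, g e, ?_, ⟨a, b, hb, ?_⟩, ⟨a', b', hb', ?_⟩, ?_⟩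
  · convert ho.comp_linearIsometryEquiv g using 1
    ext i : 1
    fin_cases i <;> simp [hp]
  · rw [hp, ← map_smul, ← map_smul, ← map_add, ← hq]; rfl
  · simp only [hp, ← map_smul, ← map_add, ← hr]; rfl
  · have hlim : Filter.Tendsto (sphereMap g.symm) (𝓝 p') (𝓝 p) := by
      have hp' : sphereMap g.symm p' = p := Subtype.ext (coe_sphereMap_symm_eq_iff.2 hp)
      exact hp' ▸ (continuous_sphereMap g.symm).tendsto p'
    refine (hlim.eventually hz).mono fun z hz => ?_
    rw [hR, ← sphereMap_symm_mem_iff, hz]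
    simp only [coe_sphereMap_symm_eq_iff, hp, map_add, map_smul]

namespace SphericalPolygon

variable {n k : ℕ} {P : SphericalPolygon n} {P' : SphericalPolygon k}

theorem neZero (P : SphericalPolygon n) : NeZero n := ⟨by have := P.three_le; omega⟩

theorem Congruent.sides_eq (h : P.Congruent P') : k = n := by
  obtain ⟨-, σ, -⟩ := h
  have := P.neZero
  have := P'.neZero
  simpa [ZMod.card] using Fintype.card_congr σ

theorem edgeLength_eq_of_map {g : E3 ≃ₗᵢ[ℝ] E3} {σ : ZMod k → ZMod n}
    (hv : ∀ i, (P'.vertex i : E3) = g (P.vertex (σ i))) (i : ZMod k) :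
    P'.edgeLength i =
      InnerProductGeometry.angle (P.vertex (σ i) : E3) (P.vertex (σ (i + 1)) : E3) := by
  rw [edgeLength, hv, hv]
  exact g.toLinearIsometry.angle_map _ _

theorem Congruent.exists_equiv (h : P.Congruent P') :
    ∃ σ : ZMod k ≃ ZMod n, (∀ i, P'.angle i = P.angle (σ i)) ∧
      ((∀ i, σ (i + 1) = σ i + 1 ∧ P'.edgeLength i = P.edgeLength (σ i)) ∨
        (∀ i, σ (i + 1) = σ i - 1 ∧ P'.edgeLength i = P.edgeLength (σ i - 1))) := by
  obtain ⟨g, σ, hσ, hv, hR⟩ := h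
  refine ⟨σ, fun i => (P'.isInteriorAngle i).unique ((P.isInteriorAngle (σ i)).map g (hv i) hR),
    hσ.imp (fun hσ i => ⟨hσ i, ?_⟩) (fun hσ i => ⟨hσ i, ?_⟩)⟩
  · rw [edgeLength_eq_of_map hv, hσ, edgeLength]
  · rw [edgeLength_eq_of_map hv, hσ, InnerProductGeometry.angle_comm, edgeLength, sub_add_cancel]

end SphericalPolygon

/-! ### Arcs -/

theorem left_mem_arc (p q : S2) : p ∈ arc p q := ⟨1, 0, by simp⟩

theorem arc_comm (p q : S2) : arc p q = arc q p := by
  ext z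
  constructor <;> rintro ⟨a, b, ha, hb, h⟩ <;> exact ⟨b, a, hb, ha, by rw [h, add_comm]⟩

theorem nonneg_comb_ne_zero {p q : S2} (h : p ≠ -q) {a b : ℝ} (ha : 0 ≤ a) (hb : 0 ≤ b)
    (hab : 0 < a + b) : a • (p : E3) + b • (q : E3) ≠ 0 := by
  intro h0
  have hpq : a • (p : E3) = b • -(q : E3) := by rw [smul_neg, eq_neg_of_add_eq_zero_left h0]
  have heq : a = b := by
    have hnorm := congrArg norm hpq
    rwa [norm_smul, norm_smul, norm_neg, norm_eq_of_mem_sphere, norm_eq_of_mem_sphere, mul_one,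
      mul_one, Real.norm_of_nonneg ha, Real.norm_of_nonneg hb] at hnorm
  subst heq
  exact h (Subtype.ext (smul_right_injective _ (by linarith : a ≠ 0) hpq))

/-- Radial projection to the sphere, with an arbitrary value at the origin. -/
noncomputable def toSphere (w : E3) : S2 :=
  if h : w = 0 then ⟨EuclideanSpace.single 0 1, by simp⟩
  else ⟨‖w‖⁻¹ • w, by simp [norm_smul, norm_ne_zero_iff.2 h]⟩

theorem coe_toSphere {w : E3} (h : w ≠ 0) : (toSphere w : E3) = ‖w‖⁻¹ • w := by
  simp [toSphere, h]

theorem toSphere_smul (z : S2) {c : ℝ} (hc : 0 < c) : toSphere (c • (z : E3)) = z := by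
  have hz : (z : E3) ≠ 0 := ne_zero_of_mem_unit_sphere z
  apply Subtype.ext
  rw [coe_toSphere (smul_ne_zero hc.ne' hz), norm_smul, norm_eq_of_mem_sphere, mul_one, smul_smul,
    Real.norm_of_nonneg hc.le, inv_mul_cancel₀ hc.ne', one_smul]

theorem continuousAt_toSphere {w : E3} (h : w ≠ 0) : ContinuousAt toSphere w := by
  rw [Topology.IsInducing.subtypeVal.continuousAt_iff]
  have hcont : ContinuousAt (fun w : E3 => ‖w‖⁻¹ • w) w :=
    (continuousAt_id.norm.inv₀ (norm_ne_zero_iff.2 h)).smul continuousAt_id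
  refine hcont.congr ?_
  filter_upwards [isOpen_ne.mem_nhds h] with w hw
  exact (coe_toSphere hw).symm

theorem toSphere_mem_arc {p q : S2} {a b : ℝ} (ha : 0 ≤ a) (hb : 0 ≤ b)
    (h : a • (p : E3) + b • (q : E3) ≠ 0) : toSphere (a • (p : E3) + b • (q : E3)) ∈ arc p q :=
  ⟨‖a • (p : E3) + b • (q : E3)‖⁻¹ * a, ‖a • (p : E3) + b • (q : E3)‖⁻¹ * b,
    mul_nonneg (by positivity) ha, mul_nonneg (by positivity) hb, by
      rw [coe_toSphere h, smul_add, smul_smul, smul_smul]⟩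

theorem zero_notMem_segment {p q : S2} (h : p ≠ -q) : (0 : E3) ∉ segment ℝ (p : E3) q := by
  rintro ⟨a, b, ha, hb, hab, h0⟩
  exact nonneg_comb_ne_zero h ha hb (hab ▸ one_pos) h0

theorem arc_eq_image_segment {p q : S2} (h : p ≠ -q) :
    arc p q = toSphere '' segment ℝ (p : E3) q := by
  ext z
  constructor
  · rintro ⟨a, b, ha, hb, hz⟩
    have hab : 0 < a + b := by
      refine (add_nonneg ha hb).lt_of_ne' fun h0 => ne_zero_of_mem_unit_sphere z ?_
      rw [hz, (add_eq_zero_iff_of_nonneg ha hb).1 h0 |>.1,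
        (add_eq_zero_iff_of_nonneg ha hb).1 h0 |>.2, zero_smul, zero_smul, add_zero]
    refine ⟨(a + b)⁻¹ • (z : E3), ⟨(a + b)⁻¹ * a, (a + b)⁻¹ * b, by positivity, by positivity,
      ?_, by rw [hz, smul_add, smul_smul, smul_smul]⟩, toSphere_smul z (inv_pos.2 hab)⟩
    rw [← mul_add, inv_mul_cancel₀ hab.ne']
  · rintro ⟨w, ⟨a, b, ha, hb, hab, rfl⟩, rfl⟩
    exact toSphere_mem_arc ha hb (nonneg_comb_ne_zero h ha hb (hab ▸ one_pos))

theorem isClosed_arc {p q : S2} (h : p ≠ -q) : IsClosed (arc p q) := by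
  rw [arc_eq_image_segment h]
  have hcompact : IsCompact (segment ℝ (p : E3) q) := by
    rw [segment_eq_image]
    exact isCompact_Icc.image (by fun_prop)
  exact (hcompact.image_of_continuousOn fun w hw => (continuousAt_toSphere
    (ne_of_mem_of_not_mem hw (zero_notMem_segment h))).continuousWithinAt).isClosed

theorem Sees.mem_arc_or {p q r : S2} {w : E3} (hq : Sees p q w) (hr : Sees p r w) :
    q ∈ arc p r ∨ r ∈ arc p q := by
  obtain ⟨a, b, hb, hq⟩ := hq
  obtain ⟨a', b', hb', hr⟩ := hr
  rcases le_total (a' / b') (a / b) with h | h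
  · refine Or.inl ⟨b * (a / b - a' / b'), b / b', mul_nonneg hb.le (sub_nonneg.2 h),
      by positivity, ?_⟩
    rw [hr, hq]
    match_scalars <;> field_simp
    ring
  · refine Or.inr ⟨b' * (a' / b' - a / b), b' / b, mul_nonneg hb'.le (sub_nonneg.2 h),
      by positivity, ?_⟩
    rw [hr, hq]
    match_scalars <;> field_simp
    ring

theorem Sees.angle_eq_of_polar_mem_arc {p q : S2} {u e : E3} {φ ψ : Real.Angle} {t : ℝ}
    (h : Frame (p : E3) u e) (hq : Sees p q (dir u e φ)) (ht : 0 < Real.sin t)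
    (hm : h.polar ψ t ∈ arc p q) : ψ = φ := by
  obtain ⟨a, b, hb, hq⟩ := hq
  obtain ⟨a', b', -, hb', hz⟩ := hm
  have hpolar : Real.cos t • (p : E3) + Real.sin t • dir u e ψ =
      (a' + b' * a) • (p : E3) + (b' * b) • dir u e φ := by
    rw [← h.coe_polar, hz, hq]
    module
  exact (h.polar_inj ht (by positivity) hpolar).2.2


/-! ### Vertices and edges of polygons -/

namespace SphericalPolygon

variable {n : ℕ} (P : SphericalPolygon n)

theorem eq_or_eq_of_vertex_mem_arc {l i : ZMod n}
    (h : P.vertex l ∈ arc (P.vertex i) (P.vertex (i + 1))) : l = i ∨ l = i + 1 := by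
  by_contra! hne
  by_cases hi : i = l + 1
  · subst hi
    have hm : P.vertex l ∈ ({P.vertex (l + 1)} : Set S2) :=
      P.edge_inter_next l ▸ ⟨left_mem_arc _ _, h⟩
    exact P.vertex_ne l hm
  · exact Set.disjoint_left.1 (P.edge_disjoint l i hne.1 hi hne.2) (left_mem_arc _ _) h

theorem vertex_injective : Function.Injective P.vertex := by
  intro l i h
  have hmem : P.vertex l ∈ arc (P.vertex i) (P.vertex (i + 1)) := h ▸ left_mem_arc _ _
  rcases P.eq_or_eq_of_vertex_mem_arc hmem with rfl | rfl
  · rfl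
  · exact absurd h.symm (P.vertex_ne i)

/-- `i'` is one of the two neighbours of `i` in the cyclic order. -/
def IsNext (i i' : ZMod n) : Prop := i' = i + 1 ∨ i' = i - 1

variable {P}

theorem IsNext.symm {i i' : ZMod n} (h : IsNext i i') : IsNext i' i := by
  rcases h with rfl | rfl
  · exact Or.inr (add_sub_cancel_right i 1).symm
  · exact Or.inl (sub_add_cancel i 1).symm

variable (P)

theorem isClosed_region : IsClosed P.region := by
  rw [P.region_eq_closure]; exact isClosed_closure

theorem isClosed_edge (i : ZMod n) : IsClosed (arc (P.vertex i) (P.vertex (i + 1))) :=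
  isClosed_arc (P.vertex_ne_neg i)

theorem edge_subset_region (i : ZMod n) : arc (P.vertex i) (P.vertex (i + 1)) ⊆ P.region :=
  (Set.subset_iUnion (fun i => arc (P.vertex i) (P.vertex (i + 1))) i).trans
    (P.frontier_region ▸ P.isClosed_region.frontier_subset)

theorem arc_subset_region {i i' : ZMod n} (h : IsNext i i') :
    arc (P.vertex i) (P.vertex i') ⊆ P.region := by
  rcases h with rfl | rfl
  · exact P.edge_subset_region i
  · simpa only [arc_comm, sub_add_cancel] using P.edge_subset_region (i - 1)

theorem eq_or_eq_of_vertex_mem_side {l i i' : ZMod n} (h : IsNext i i')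
    (hl : P.vertex l ∈ arc (P.vertex i) (P.vertex i')) : l = i ∨ l = i' := by
  rcases h with rfl | rfl
  · exact P.eq_or_eq_of_vertex_mem_arc hl
  · rw [or_comm]
    simpa only [sub_add_cancel] using
      P.eq_or_eq_of_vertex_mem_arc (i := i - 1) (by rwa [sub_add_cancel, arc_comm])

/-- Near a vertex, the frontier consists of the two adjacent edges. -/
theorem eventually_polar_notMem_frontier {i : ZMod n} {u e : E3}
    (h : Frame (P.vertex i : E3) u e) {φ φ' ψ : Real.Angle}
    (hnext : Sees (P.vertex i) (P.vertex (i + 1)) (dir u e φ))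
    (hprev : Sees (P.vertex i) (P.vertex (i - 1)) (dir u e φ')) (hφ : ψ ≠ φ) (hφ' : ψ ≠ φ') :
    ∀ᶠ t in 𝓝[>] 0, h.polar ψ t ∉ frontier P.region := by
  have := P.neZero
  have hedge (j : ZMod n) :
      ∀ᶠ t in 𝓝[>] 0, h.polar ψ t ∉ arc (P.vertex j) (P.vertex (j + 1)) := by
    by_cases hj : P.vertex i ∈ arc (P.vertex j) (P.vertex (j + 1))
    · filter_upwards [eventually_sin_pos] with t ht hm
      rcases P.eq_or_eq_of_vertex_mem_arc hj with rfl | rfl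
      · exact hφ (hnext.angle_eq_of_polar_mem_arc h ht hm)
      · rw [add_sub_cancel_right] at hprev
        exact hφ' (hprev.angle_eq_of_polar_mem_arc h ht (arc_comm _ _ ▸ hm))
    · exact (h.tendsto_polar ψ).eventually ((P.isClosed_edge j).isOpen_compl.mem_nhds hj)
  filter_upwards [Filter.eventually_all.2 hedge] with t ht
  simpa only [P.frontier_region, Set.mem_iUnion, not_exists] using ht

end SphericalPolygon


/-! ### The corners of a tiling at a vertex -/

namespace SphericalPolygon

theorem IsNext.vertex_ne {n : ℕ} (P : SphericalPolygon n) {i i' : ZMod n} (h : IsNext i i') :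
    P.vertex i ≠ P.vertex i' := by
  rcases h with rfl | rfl
  · exact P.vertex_ne i
  · simpa only [sub_add_cancel] using (P.vertex_ne (i - 1)).symm

end SphericalPolygon

namespace SphericalTiling

open SphericalPolygon

variable (T : SphericalTiling) {v : S2}

instance (k : Fin T.numTiles) : NeZero (T.sides k) := (T.tile k).neZero

theorem eq_of_tile_eq {c c' : Σ k, ZMod (T.sides k)}
    (hc : c ∈ T.cornersAt v) (hc' : c' ∈ T.cornersAt v) (h : c.1 = c'.1) : c = c' := by
  obtain ⟨k, i⟩ := c
  obtain ⟨k', i'⟩ := c'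
  obtain rfl : k = k' := h
  exact congrArg _ ((T.tile k).vertex_injective (Eq.trans hc (Eq.symm hc')))

theorem vertex_eq_of_mem_side {k k' : Fin T.numTiles} {i i₁ : ZMod (T.sides k)}
    {i' i₁' : ZMod (T.sides k')} (hv : (T.tile k).vertex i = (T.tile k').vertex i')
    (hi : IsNext i i₁) (hi' : IsNext i' i₁')
    (hm : (T.tile k).vertex i₁ ∈ arc ((T.tile k').vertex i') ((T.tile k').vertex i₁')) :
    (T.tile k).vertex i₁ = (T.tile k').vertex i₁' := by
  obtain ⟨l, hl⟩ := T.edge_to_edge k i₁ k' ((T.tile k').arc_subset_region hi' hm)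
  rw [← hl] at hm ⊢
  rcases (T.tile k').eq_or_eq_of_vertex_mem_side hi' hm with rfl | rfl
  · exact absurd (hv.trans hl) (hi.vertex_ne _)
  · rfl

theorem vertex_eq_of_sees {k k' : Fin T.numTiles} {i i₁ : ZMod (T.sides k)}
    {i' i₁' : ZMod (T.sides k')} (hv : (T.tile k).vertex i = v) (hv' : (T.tile k').vertex i' = v)
    (hi : IsNext i i₁) (hi' : IsNext i' i₁') {w : E3}
    (hs : Sees v ((T.tile k).vertex i₁) w) (hs' : Sees v ((T.tile k').vertex i₁') w) :
    (T.tile k).vertex i₁ = (T.tile k').vertex i₁' := by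
  rcases hs.mem_arc_or hs' with h | h
  · exact T.vertex_eq_of_mem_side (hv.trans hv'.symm) hi hi' (by rwa [hv'])
  · exact (T.vertex_eq_of_mem_side (hv'.trans hv.symm) hi' hi (by rwa [hv])).symm

theorem eventually_notMem_region (hne : (T.cornersAt v).Nonempty) {k : Fin T.numTiles}
    (hk : ∀ i, (T.tile k).vertex i ≠ v) : ∀ᶠ z in 𝓝 v, z ∉ (T.tile k).region := by
  obtain ⟨⟨j, i⟩, rfl⟩ := hne
  refine (T.tile k).isClosed_region.isOpen_compl.mem_nhds fun hm => ?_
  obtain ⟨l, hl⟩ := T.edge_to_edge j i k hm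
  exact hk l hl

/-- The position of the corners at `v` in the frame `(u, e)`: the corner `c` occupies the arc of
directions that starts at `start c`; it is bounded by the sides to the neighbours `st c` and
`en c` of `c`, in the order of increasing directions. -/
structure CornerPlacement (v : S2) (u e : E3) where
  start : T.cornersAt v → Real.Angle
  st : ∀ c : T.cornersAt v, ZMod (T.sides c.1.1)
  en : ∀ c : T.cornersAt v, ZMod (T.sides c.1.1)
  st_en : ∀ c, (st c = c.1.2 + 1 ∧ en c = c.1.2 - 1) ∨ (st c = c.1.2 - 1 ∧ en c = c.1.2 + 1)
  isSector : ∀ c, IsSector (T.tile c.1.1).region v u e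
    (circleArc (start c) ((T.tile c.1.1).angle c.1.2))
  sees_st : ∀ c, Sees v ((T.tile c.1.1).vertex (st c)) (dir u e (start c))
  sees_en : ∀ c, Sees v ((T.tile c.1.1).vertex (en c))
    (dir u e (start c + (T.tile c.1.1).angle c.1.2))

theorem nonempty_cornerPlacement {u e : E3} (hf : Frame (v : E3) u e) :
    Nonempty (T.CornerPlacement v u e) := by
  have hplace (c : T.cornersAt v) : ∃ (A : Real.Angle) (st en : ZMod (T.sides c.1.1)),
      ((st = c.1.2 + 1 ∧ en = c.1.2 - 1) ∨ (st = c.1.2 - 1 ∧ en = c.1.2 + 1)) ∧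
      IsSector (T.tile c.1.1).region v u e (circleArc A ((T.tile c.1.1).angle c.1.2)) ∧
      Sees v ((T.tile c.1.1).vertex st) (dir u e A) ∧
      Sees v ((T.tile c.1.1).vertex en) (dir u e (A + (T.tile c.1.1).angle c.1.2)) := by
    obtain ⟨⟨k, i⟩, rfl⟩ := c
    obtain ⟨A, hA, hsees | hsees⟩ := ((T.tile k).isInteriorAngle i).exists_arc hf
    · exact ⟨A, i + 1, i - 1, Or.inl ⟨rfl, rfl⟩, hA, hsees⟩
    · exact ⟨A, i - 1, i + 1, Or.inr ⟨rfl, rfl⟩, hA, hsees⟩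
  choose A st en hse hs hst hen using hplace
  exact ⟨⟨A, st, en, hse, hs, hst, hen⟩⟩

namespace CornerPlacement

variable {T} {u e : E3} (L : T.CornerPlacement v u e)

theorem isNext_st (c : T.cornersAt v) : IsNext c.1.2 (L.st c) := (L.st_en c).imp And.left And.left

theorem isNext_en (c : T.cornersAt v) : IsNext c.1.2 (L.en c) :=
  (L.st_en c).symm.imp And.right And.right

theorem exists_mem_circleArc (hf : Frame (v : E3) u e) (hne : (T.cornersAt v).Nonempty)
    (ψ : Real.Angle) :
    ∃ c : T.cornersAt v, ψ ∈ circleArc (L.start c) ((T.tile c.1.1).angle c.1.2) := by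
  by_contra! hψ
  have houtside (k : Fin T.numTiles) : ∀ᶠ t in 𝓝[>] 0, hf.polar ψ t ∉ (T.tile k).region := by
    by_cases hk : ∃ i, (T.tile k).vertex i = v
    · obtain ⟨i, hi⟩ := hk
      filter_upwards [(L.isSector ⟨⟨k, i⟩, hi⟩).eventually_polar hf ψ] with t ht hm
      exact hψ ⟨⟨k, i⟩, hi⟩ (ht.1 hm)
    · exact (hf.tendsto_polar ψ).eventually (T.eventually_notMem_region hne (not_exists.1 hk))
  obtain ⟨t, ht⟩ := (Filter.eventually_all.2 houtside).exists
  have hcover : hf.polar ψ t ∈ ⋃ j, (T.tile j).region := T.cover ▸ Set.mem_univ _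
  obtain ⟨k, hk⟩ := Set.mem_iUnion.1 hcover
  exact ht k hk

theorem eventually_polar_notMem_frontier (hf : Frame (v : E3) u e) (c : T.cornersAt v)
    {ψ : Real.Angle} (hst : ψ ≠ L.start c)
    (hen : ψ ≠ L.start c + (T.tile c.1.1).angle c.1.2) :
    ∀ᶠ t in 𝓝[>] 0, hf.polar ψ t ∉ frontier (T.tile c.1.1).region := by
  have hsees_st := L.sees_st c
  have hsees_en := L.sees_en c
  have hse := L.st_en c
  generalize L.start c = A, L.st c = st, L.en c = en at *
  obtain ⟨⟨k, i⟩, rfl⟩ := c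
  rcases hse with ⟨rfl, rfl⟩ | ⟨rfl, rfl⟩
  · exact (T.tile k).eventually_polar_notMem_frontier hf hsees_st hsees_en hst hen
  · exact (T.tile k).eventually_polar_notMem_frontier hf hsees_en hsees_st hen hst

theorem eq_or_eq_of_mem_circleArc (hf : Frame (v : E3) u e) {c c' : T.cornersAt v} (hcc : c ≠ c')
    {ψ : Real.Angle} (h : ψ ∈ circleArc (L.start c) ((T.tile c.1.1).angle c.1.2))
    (h' : ψ ∈ circleArc (L.start c') ((T.tile c'.1.1).angle c'.1.2)) :
    ψ = L.start c ∨ ψ = L.start c + (T.tile c.1.1).angle c.1.2 := by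
  by_contra! hψ
  have hk : c.1.1 ≠ c'.1.1 := fun hk => hcc (Subtype.ext (T.eq_of_tile_eq c.2 c'.2 hk))
  obtain ⟨t, hfr, hmem, hmem'⟩ := ((L.eventually_polar_notMem_frontier hf c hψ.1 hψ.2).and
    (((L.isSector c).eventually_polar hf ψ).and ((L.isSector c').eventually_polar hf ψ))).exists
  have hint : hf.polar ψ t ∈ interior (T.tile c.1.1).region := by
    rw [← self_sdiff_frontier]
    exact ⟨hmem.2 h, hfr⟩
  have hcl : hf.polar ψ t ∈ closure (interior (T.tile c'.1.1).region) := by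
    rw [← (T.tile c'.1.1).region_eq_closure]
    exact hmem'.2 h'
  exact Set.disjoint_left.1 ((T.disjoint_interior hk).closure_right isOpen_interior) hint hcl

theorem circleTiling (hf : Frame (v : E3) u e) (hne : (T.cornersAt v).Nonempty) :
    CircleTiling L.start (fun c : T.cornersAt v => (T.tile c.1.1).angle c.1.2) where
  pos c := ((T.tile c.1.1).isInteriorAngle _).1
  lt c := ((T.tile c.1.1).isInteriorAngle _).2.1
  cover := L.exists_mem_circleArc hf hne
  overlap _ _ _ hne := L.eq_or_eq_of_mem_circleArc hf hne

end CornerPlacement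

/-- The cyclic arrangement of the corners at a vertex: `st c` and `en c` are the two neighbours
in its tile of the corner `c`, and the last side of a corner is the first side of the next one. -/
structure VertexArrangement (v : S2) where
  next : Equiv.Perm (T.cornersAt v)
  st : ∀ c : T.cornersAt v, ZMod (T.sides c.1.1)
  en : ∀ c : T.cornersAt v, ZMod (T.sides c.1.1)
  st_en : ∀ c, (st c = c.1.2 + 1 ∧ en c = c.1.2 - 1) ∨ (st c = c.1.2 - 1 ∧ en c = c.1.2 + 1)
  next_ne : ∀ c, next c ≠ c
  vertex_next : ∀ c, (T.tile c.1.1).vertex (en c) =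
    (T.tile (next c).1.1).vertex (st (next c))
  st_inj : ∀ c c', (T.tile c.1.1).vertex (st c) = (T.tile c'.1.1).vertex (st c') → c = c'
  en_inj : ∀ c c', (T.tile c.1.1).vertex (en c) = (T.tile c'.1.1).vertex (en c') → c = c'
  add_angle : ∀ c, next (next c) = c →
    (T.tile c.1.1).angle c.1.2 + (T.tile (next c).1.1).angle (next c).1.2 = 2 * π
  sum_angle : ∑ᶠ c : T.cornersAt v, (T.tile c.1.1).angle c.1.2 = 2 * π

theorem nonempty_vertexArrangement (hne : (T.cornersAt v).Nonempty) :
    Nonempty (T.VertexArrangement v) := by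
  have ⟨c₀, hc₀⟩ := hne
  obtain ⟨u, e, hf, -⟩ := ((T.tile c₀.1).isInteriorAngle c₀.2).exists_frame
  rw [show (T.tile c₀.1).vertex c₀.2 = v from hc₀] at hf
  obtain ⟨L⟩ := T.nonempty_cornerPlacement hf
  have hC := L.circleTiling hf hne
  have := Fintype.ofFinite (T.cornersAt v)
  choose next hnext using hC.exists_next
  have hinj : Function.Injective next := fun c c' h =>
    hC.end_injective ((hnext c).symm.trans ((congrArg L.start h).trans (hnext c')))
  exact ⟨{
    next := Equiv.ofBijective next (Finite.injective_iff_bijective.1 hinj)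
    st := L.st
    en := L.en
    st_en := L.st_en
    next_ne := fun c h => coe_angle_ne_zero (hC.pos c) (hC.lt c)
      (left_eq_add.1 ((congrArg L.start h).symm.trans (hnext c)))
    vertex_next := fun c => T.vertex_eq_of_sees c.2 (next c).2 (L.isNext_en c)
      (L.isNext_st (next c)) (L.sees_en c) (hnext c ▸ L.sees_st (next c))
    st_inj := fun c c' h => hC.start_injective ((L.sees_st c).angle_eq hf (h ▸ L.sees_st c'))
    en_inj := fun c c' h => hC.end_injective ((L.sees_en c).angle_eq hf (h ▸ L.sees_en c'))
    add_angle := fun c h => hC.add_eq_of_mutual (hnext c)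
      ((congrArg L.start h).symm.trans (hnext (next c)))
    sum_angle := (finsum_eq_sum_of_fintype _).trans hC.sum_eq }⟩

end SphericalTiling


/-! ### The corners of a polygon have the same orientation -/

/-- An interior angle together with its orientation: `s = 1` if the region lies to the left of
the arc from `p` to `q`, and `s = -1` if it lies to the right. -/
def IsOrientedAngle (R : Set S2) (p q r : S2) (θ s : ℝ) : Prop :=
  0 < θ ∧ θ < 2 * π ∧ (s = 1 ∨ s = -1) ∧ ∃ u e : E3, Frame (p : E3) u e ∧
    cross3 (p : E3) u = s • e ∧ Sees p q (dir u e 0) ∧ Sees p r (dir u e θ) ∧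
    IsSector R p u e (circleArc 0 θ)

theorem IsInteriorAngle.exists_oriented {R : Set S2} {p q r : S2} {θ : ℝ}
    (h : IsInteriorAngle R p q r θ) : ∃ s, IsOrientedAngle R p q r θ s := by
  obtain ⟨u, e, hf, hq, hr, hs⟩ := h.exists_frame
  obtain ⟨s, hs1, he⟩ := hf.cross3_eq_smul
  exact ⟨s, h.1, h.2.1, hs1, u, e, hf, he, hq, hr, hs⟩

theorem Frame.cross3_dir {p u e : E3} (h : Frame p u e) {s : ℝ} (hs : cross3 p u = s • e)
    (φ : Real.Angle) : cross3 p (dir u e φ) = s • dir u e (φ + (π / 2 : ℝ)) := by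
  have hpp : cross3 p (cross3 p u) = -u := by
    rw [cross3_cross3, h.pu, h.pp, zero_smul, one_smul, zero_sub]
  have hss : s * s = 1 := by
    have hn := inner_cross3_cross3 p u p u
    rwa [hs, inner_smul_left, inner_smul_right, h.ee, h.pp, h.uu, h.pu, h.up, mul_one, mul_one,
      mul_zero, sub_zero] at hn
  have he : cross3 p e = -s • u := by
    rw [hs, map_smul] at hpp
    rw [← one_smul ℝ (cross3 p e), ← hss, mul_smul, hpp, smul_neg, neg_smul]
  rw [dir_add, dir, map_add, map_smul, map_smul, hs, he]
  simp only [dir, Real.Angle.cos_coe, Real.Angle.sin_coe, Real.cos_pi_div_two,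
    Real.sin_pi_div_two, Real.Angle.cos_add, Real.Angle.sin_add]
  module

theorem IsOrientedAngle.symm {R : Set S2} {p q r : S2} {θ s : ℝ}
    (h : IsOrientedAngle R p q r θ s) : IsOrientedAngle R p r q θ (-s) := by
  obtain ⟨h0, h1, hs1, u, e, hf, he, hq, hr, hs⟩ := h
  have hreverse (φ : Real.Angle) :
      dir (dir u e θ) (-dir u e (θ + (π / 2 : ℝ))) φ = dir u e (θ - φ) := by
    rw [sub_eq_add_neg, dir_add u e θ (-φ), Real.Angle.cos_neg, Real.Angle.sin_neg, neg_smul,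
      ← smul_neg]
    rfl
  refine ⟨h0, h1, by simpa [neg_eq_iff_eq_neg, or_comm] using hs1, dir u e θ,
    -dir u e (θ + (π / 2 : ℝ)), ?_, ?_, ?_, ?_, ?_⟩
  · constructor <;> simp only [hf.pp, hf.inner_dir, hf.inner_dir_dir, inner_neg_left,
      inner_neg_right, sub_self, sub_add_cancel_left, Real.Angle.cos_neg, Real.Angle.cos_zero,
      Real.Angle.cos_coe, Real.cos_pi_div_two, neg_neg, neg_zero]
  · rw [hf.cross3_dir he, smul_neg, neg_smul, neg_neg]
  · rwa [hreverse, sub_zero]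
  · rwa [hreverse, sub_self]
  · have hsector := hs.change _ hreverse
    simp only [Set.preimage, sub_mem_circleArc, sub_zero, sub_self, Set.ofPred_mem_eq] at hsector
    exact hsector

theorem mem_of_isPreconnected_of_disjoint_frontier {X : Type*} [TopologicalSpace X]
    {S R : Set X} (hS : IsPreconnected S) (hd : Disjoint S (frontier R)) {x y : X} (hx : x ∈ S)
    (hy : y ∈ S) (hxR : x ∈ R) : y ∈ R := by
  have hsub : S ⊆ interior R ∪ interior Rᶜ :=
    compl_frontier_eq_union_interior (s := R) ▸ Set.subset_compl_iff_disjoint_right.2 hd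
  have hdisj : Disjoint (interior R) (interior Rᶜ) :=
    disjoint_compl_right.mono interior_subset interior_subset
  have hxi : x ∈ interior R :=
    (hsub hx).resolve_right fun hc => interior_subset hc hxR
  exact interior_subset
    (hS.subset_left_of_subset_union isOpen_interior isOpen_interior hdisj hsub ⟨x, hx, hxi⟩ hy)

theorem norm_smul_toSphere (w : E3) : ‖w‖ • (toSphere w : E3) = w := by
  rcases eq_or_ne w 0 with rfl | hw
  · rw [norm_zero, zero_smul]
  · rw [coe_toSphere hw, smul_smul, mul_inv_cancel₀ (norm_ne_zero_iff.2 hw), one_smul]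

theorem cross3_ne_zero {p q : S2} (h : p ≠ q) (h' : p ≠ -q) : cross3 (p : E3) q ≠ 0 := by
  intro h0
  have hsq := inner_cross3_cross3 (p : E3) q p q
  rw [h0, inner_zero_left, S2.inner_self, S2.inner_self, mul_one,
    real_inner_comm (p : E3) (q : E3), eq_comm, sub_eq_zero, eq_comm, mul_self_eq_one_iff] at hsq
  have hp := norm_eq_of_mem_sphere p
  have hq := norm_eq_of_mem_sphere q
  rcases hsq with h1 | h1
  · exact h (Subtype.ext ((inner_eq_one_iff_of_norm_eq_one hp hq).1 h1))
  · exact h' (Subtype.ext ((inner_eq_neg_one_iff_of_norm_eq_one hp hq).1 h1))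

/-- The line `κ = const` runs parallel to the chord from `p` to `q`, to the left of it
if `κ > 0`. -/
noncomputable def parallel (p q : E3) (τ κ : ℝ) : E3 := (1 - τ) • p + τ • q + κ • cross3 p q

section Parallel

variable {p q : S2} {τ κ : ℝ}

theorem parallel_swap (p q : E3) (τ κ : ℝ) : parallel q p τ κ = parallel p q (1 - τ) (-κ) := by
  rw [parallel, parallel, cross3_swap p q]
  module

theorem inner_cross3_parallel (p q : E3) (τ κ : ℝ) :
    ⟪cross3 p q, parallel p q τ κ⟫ = κ * ⟪cross3 p q, cross3 p q⟫ := by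
  rw [parallel, inner_add_right, inner_add_right, inner_smul_right, inner_smul_right,
    inner_smul_right, real_inner_comm, inner_cross3_left, real_inner_comm, inner_cross3_right]
  ring

theorem cross3_parallel_zero (p q : E3) (τ : ℝ) :
    cross3 p (parallel p q τ 0) = τ • cross3 p q := by
  rw [parallel, map_add, map_add, map_smul, map_smul, map_smul, cross3_self]
  module

theorem parallel_zero_ne_zero (h : p ≠ -q) (h0 : 0 ≤ τ) (h1 : τ ≤ 1) :
    parallel (p : E3) q τ 0 ≠ 0 := by
  rw [parallel, zero_smul, add_zero]
  exact nonneg_comb_ne_zero h (sub_nonneg.2 h1) h0 (by linarith)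

theorem parallel_ne_zero (h : cross3 (p : E3) q ≠ 0) (hκ : κ ≠ 0) : parallel (p : E3) q τ κ ≠ 0 :=
  fun h0 => mul_ne_zero hκ (inner_self_ne_zero.2 h)
    (by rw [← inner_cross3_parallel (p : E3) q τ κ, h0, inner_zero_right])

theorem continuousAt_toSphere_parallel {x : ℝ × ℝ} (h : parallel (p : E3) q x.1 x.2 ≠ 0) :
    ContinuousAt (fun x : ℝ × ℝ => toSphere (parallel (p : E3) q x.1 x.2)) x :=
  (continuousAt_toSphere h).comp (f := fun x : ℝ × ℝ => parallel (p : E3) q x.1 x.2)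
    (by unfold parallel; fun_prop)

theorem toSphere_parallel_mem_arc (h : p ≠ -q) (h0 : 0 ≤ τ) (h1 : τ ≤ 1) :
    toSphere (parallel (p : E3) q τ 0) ∈ arc p q := by
  have hne := parallel_zero_ne_zero h h0 h1
  rw [parallel, zero_smul, add_zero] at hne ⊢
  exact toSphere_mem_arc (sub_nonneg.2 h1) h0 hne

theorem toSphere_parallel_ne_left (h : cross3 (p : E3) q ≠ 0) (hτ : τ ≠ 0) :
    toSphere (parallel (p : E3) q τ 0) ≠ p := by
  intro heq
  have hself : ‖parallel (p : E3) q τ 0‖ • (p : E3) = parallel (p : E3) q τ 0 := by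
    simpa only [heq] using norm_smul_toSphere (parallel (p : E3) q τ 0)
  refine smul_ne_zero hτ h ?_
  rw [← cross3_parallel_zero, ← hself, map_smul, cross3_self, smul_zero]

theorem toSphere_parallel_notMem_arc (h : cross3 (p : E3) q ≠ 0) (hκ : κ ≠ 0) :
    toSphere (parallel (p : E3) q τ κ) ∉ arc p q := by
  rintro ⟨a, b, -, -, hz⟩
  refine mul_ne_zero hκ (inner_self_ne_zero.2 h) ?_
  rw [← inner_cross3_parallel (p : E3) q τ κ, ← norm_smul_toSphere (parallel (p : E3) q τ κ), hz,
    inner_smul_right, inner_add_right, inner_smul_right, inner_smul_right, real_inner_comm,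
    inner_cross3_left, real_inner_comm, inner_cross3_right]
  ring

end Parallel

theorem sqrt_smul_dir_arctan (u e : E3) (x : ℝ) :
    √(1 + x ^ 2) • dir u e (Real.arctan x) = u + x • e := by
  have hne : √(1 + x ^ 2) ≠ 0 := (Real.sqrt_pos.2 (by positivity)).ne'
  rw [dir_coe, Real.cos_arctan, Real.sin_arctan, smul_add, smul_smul, smul_smul,
    mul_one_div_cancel hne, mul_div_cancel₀ _ hne, one_smul]

theorem coe_mem_circleArc_zero_iff {θ φ : ℝ} (h0 : -(2 * π - θ) < φ) (h1 : φ ≤ θ) :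
    (φ : Real.Angle) ∈ circleArc 0 θ ↔ 0 ≤ φ := by
  rcases le_or_gt 0 φ with h | h
  · simpa [h] using add_coe_mem_circleArc (A := 0) h h1
  · have hnot := add_coe_notMem_circleArc (A := 0) (θ := θ) (t := φ + 2 * π) (by linarith)
      (by linarith)
    simpa [h.not_ge] using hnot

theorem Frame.exists_coe_toSphere_eq {p w : E3} {u e : E3} (h : Frame p u e) {a b : ℝ} (hb : 0 < b)
    {ψ : Real.Angle} (hw : w = a • p + b • dir u e ψ) :
    ∃ a' b' : ℝ, 0 < b' ∧ (toSphere w : E3) = a' • p + b' • dir u e ψ := by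
  have hne : w ≠ 0 := by
    rintro rfl
    have hinner := congrArg (fun w => ⟪dir u e ψ, w⟫) hw
    simp only [inner_zero_right, inner_add_right, inner_smul_right, real_inner_comm p,
      h.inner_dir, h.inner_dir_self, mul_zero, zero_add, mul_one] at hinner
    exact hb.ne hinner
  refine ⟨‖w‖⁻¹ * a, ‖w‖⁻¹ * b, mul_pos (inv_pos.2 (norm_pos_iff.2 hne)) hb, ?_⟩
  rw [coe_toSphere hne, mul_smul, mul_smul, ← smul_add, ← hw]

theorem IsOrientedAngle.eventually_parallel_mem_iff {R : Set S2} {p q r : S2} {θ s : ℝ}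
    (h : IsOrientedAngle R p q r θ s) : ∀ᶠ τ in 𝓝[>] (0 : ℝ), ∀ᶠ κ in 𝓝 (0 : ℝ),
      (toSphere (parallel (p : E3) q τ κ) ∈ R ↔ 0 ≤ s * κ) := by
  obtain ⟨h0, h2π, -, u, e, hf, he, ⟨a, b, hb, hq⟩, -, hs⟩ := h
  rw [dir_zero] at hq
  have hpolar {τ : ℝ} (hτ : 0 < τ) (κ : ℝ) : parallel (p : E3) q τ κ =
      (1 - τ + τ * a) • (p : E3) +
        (b * τ * √(1 + (s * κ / τ) ^ 2)) • dir u e (Real.arctan (s * κ / τ)) := by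
    rw [mul_smul, sqrt_smul_dir_arctan, parallel, hq, map_add, map_smul, map_smul, cross3_self, he]
    match_scalars <;> field_simp
  have hlim : Filter.Tendsto (fun x : ℝ × ℝ => toSphere (parallel (p : E3) q x.1 x.2))
      (𝓝 (0, 0)) (𝓝 p) := by
    have hzero : parallel (p : E3) q 0 0 = (1 : ℝ) • (p : E3) := by simp [parallel]
    have hcont := continuousAt_toSphere_parallel (p := p) (q := q) (x := (0, 0))
      (by simpa [hzero] using ne_zero_of_mem_unit_sphere p)
    simpa only [hzero, toSphere_smul p one_pos] using hcont.tendsto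
  filter_upwards [nhdsWithin_le_nhds (hlim.eventually hs).curry_nhds, self_mem_nhdsWithin]
    with τ hsector (hτ : 0 < τ)
  have harctan : Filter.Tendsto (fun κ => Real.arctan (s * κ / τ)) (𝓝 0) (𝓝 0) := by
    have hcont : Continuous fun κ : ℝ => Real.arctan (s * κ / τ) := by fun_prop
    simpa using hcont.tendsto 0
  filter_upwards [hsector, harctan.eventually
    (Ioo_mem_nhds (neg_lt_zero.2 (sub_pos.2 h2π)) h0)] with κ hsector hφ
  obtain ⟨a', b', hb', hz⟩ := hf.exists_coe_toSphere_eq (by positivity) (hpolar hτ κ)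
  rw [hsector _ _ _ hb' hz, coe_mem_circleArc_zero_iff hφ.1 hφ.2.le, Real.arctan_nonneg,
    le_div_iff₀ hτ, zero_mul]

namespace SphericalPolygon

variable {n : ℕ} (P : SphericalPolygon n)

theorem cross3_vertex_ne_zero (i : ZMod n) :
    cross3 (P.vertex i : E3) (P.vertex (i + 1)) ≠ 0 :=
  cross3_ne_zero (P.vertex_ne i) (P.vertex_ne_neg i)

theorem notMem_edge_of_mem_edge {i j : ZMod n} (hij : i ≠ j) {z : S2}
    (hz : z ∈ arc (P.vertex i) (P.vertex (i + 1))) (hp : z ≠ P.vertex i)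
    (hq : z ≠ P.vertex (i + 1)) : z ∉ arc (P.vertex j) (P.vertex (j + 1)) := by
  intro hzj
  by_cases hj : j = i + 1
  · subst hj
    exact hq (P.edge_inter_next i ▸ ⟨hz, hzj⟩ : z ∈ ({P.vertex (i + 1)} : Set S2))
  by_cases hi : i = j + 1
  · subst hi
    exact hp (P.edge_inter_next j ▸ ⟨hzj, hz⟩ : z ∈ ({P.vertex (j + 1)} : Set S2))
  exact Set.disjoint_left.1 (P.edge_disjoint i j hij hj hi) hz hzj

theorem eventually_parallel_notMem_edge {i j : ZMod n} (hij : i ≠ j) {τ₀ τ₁ : ℝ} (h0 : 0 < τ₀)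
    (h1 : τ₁ < 1) : ∀ᶠ κ in 𝓝 (0 : ℝ), ∀ τ ∈ Set.Icc τ₀ τ₁,
      toSphere (parallel (P.vertex i : E3) (P.vertex (i + 1)) τ κ) ∉
        arc (P.vertex j) (P.vertex (j + 1)) := by
  refine isCompact_Icc.eventually_forall_of_forall_eventually fun τ hτ => ?_
  have hτ0 : 0 < τ := h0.trans_le hτ.1
  have hτ1 : τ < 1 := hτ.2.trans_lt h1
  have hcross := P.cross3_vertex_ne_zero i
  have hright :
      toSphere (parallel (P.vertex i : E3) (P.vertex (i + 1)) τ 0) ≠ P.vertex (i + 1) := by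
    have hne := toSphere_parallel_ne_left (τ := 1 - τ)
      (cross3_swap (P.vertex i : E3) _ ▸ neg_ne_zero.2 hcross) (sub_pos.2 hτ1).ne'
    rwa [parallel_swap, sub_sub_cancel, neg_zero] at hne
  have hcont := continuousAt_toSphere_parallel (x := (τ, 0))
    (parallel_zero_ne_zero (P.vertex_ne_neg i) hτ0.le hτ1.le)
  have hnot := P.notMem_edge_of_mem_edge hij
    (toSphere_parallel_mem_arc (P.vertex_ne_neg i) hτ0.le hτ1.le)
    (toSphere_parallel_ne_left hcross hτ0.ne') hright
  exact (hcont.comp (f := Prod.swap) (x := ((0 : ℝ), τ)) continuous_swap.continuousAt).eventually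
    ((P.isClosed_edge j).isOpen_compl.mem_nhds hnot)

theorem eventually_parallel_notMem_frontier (i : ZMod n) {τ₀ τ₁ : ℝ} (h0 : 0 < τ₀) (h1 : τ₁ < 1) :
    ∀ᶠ κ in 𝓝[>] (0 : ℝ), ∀ τ ∈ Set.Icc τ₀ τ₁,
      toSphere (parallel (P.vertex i : E3) (P.vertex (i + 1)) τ κ) ∉ frontier P.region := by
  have := P.neZero
  have hedge (j : ZMod n) : ∀ᶠ κ in 𝓝[>] (0 : ℝ), ∀ τ ∈ Set.Icc τ₀ τ₁,
      toSphere (parallel (P.vertex i : E3) (P.vertex (i + 1)) τ κ) ∉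
        arc (P.vertex j) (P.vertex (j + 1)) := by
    rcases eq_or_ne i j with rfl | hij
    · filter_upwards [self_mem_nhdsWithin] with κ hκ τ _
      exact toSphere_parallel_notMem_arc (P.cross3_vertex_ne_zero i) (ne_of_gt hκ)
    · exact nhdsWithin_le_nhds (P.eventually_parallel_notMem_edge hij h0 h1)
  filter_upwards [Filter.eventually_all.2 hedge] with κ hκ τ hτ
  simpa only [P.frontier_region, Set.mem_iUnion, not_exists] using fun j => hκ j τ hτ

theorem parallel_mem_region_iff {i : ZMod n} {τ₀ τ₁ κ : ℝ} (hle : τ₀ ≤ τ₁) (hκ : κ ≠ 0)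
    (h : ∀ τ ∈ Set.Icc τ₀ τ₁,
      toSphere (parallel (P.vertex i : E3) (P.vertex (i + 1)) τ κ) ∉ frontier P.region) :
    toSphere (parallel (P.vertex i : E3) (P.vertex (i + 1)) τ₀ κ) ∈ P.region ↔
      toSphere (parallel (P.vertex i : E3) (P.vertex (i + 1)) τ₁ κ) ∈ P.region := by
  set f : ℝ → S2 := fun τ => toSphere (parallel (P.vertex i : E3) (P.vertex (i + 1)) τ κ)
  have hpath : IsPreconnected (f '' Set.Icc τ₀ τ₁) := by
    refine isPreconnected_Icc.image f fun τ _ => ContinuousAt.continuousWithinAt ?_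
    exact (continuousAt_toSphere_parallel (x := (τ, κ)) (parallel_ne_zero
      (P.cross3_vertex_ne_zero i) hκ)).comp (f := fun τ => (τ, κ)) (by fun_prop)
  have hdisj : Disjoint (f '' Set.Icc τ₀ τ₁) (frontier P.region) :=
    Set.disjoint_left.2 (Set.forall_mem_image.2 h)
  have hmem₀ := Set.mem_image_of_mem f (Set.left_mem_Icc.2 hle)
  have hmem₁ := Set.mem_image_of_mem f (Set.right_mem_Icc.2 hle)
  exact ⟨mem_of_isPreconnected_of_disjoint_frontier hpath hdisj hmem₀ hmem₁,
    mem_of_isPreconnected_of_disjoint_frontier hpath hdisj hmem₁ hmem₀⟩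

/-- A parallel of the edge from `i` to `i + 1` joins the neighbourhoods of the two vertices
without leaving or entering the region. -/
theorem orientation_eq_of_next {i : ZMod n} {s s' : ℝ}
    (h : IsOrientedAngle P.region (P.vertex i) (P.vertex (i + 1)) (P.vertex (i - 1)) (P.angle i) s)
    (h' : IsOrientedAngle P.region (P.vertex (i + 1)) (P.vertex (i + 1 + 1))
      (P.vertex (i + 1 - 1)) (P.angle (i + 1)) s') : s = s' := by
  rw [add_sub_cancel_right] at h'
  have hhalf : ∀ᶠ τ in 𝓝[>] (0 : ℝ), τ ∈ Set.Ioo (0 : ℝ) (1 / 2) := Ioo_mem_nhdsGT (by norm_num)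
  obtain ⟨τ₀, hleft, hτ₀⟩ := (h.eventually_parallel_mem_iff.and hhalf).exists
  obtain ⟨τ₁, hright, hτ₁⟩ := (h'.symm.eventually_parallel_mem_iff.and hhalf).exists
  have hneg : Filter.Tendsto (fun κ : ℝ => -κ) (𝓝 0) (𝓝 0) := by
    simpa using (continuous_neg (G := ℝ)).tendsto 0
  have havoid := P.eventually_parallel_notMem_frontier i hτ₀.1 (τ₁ := 1 - τ₁) (by linarith [hτ₁.1])
  obtain ⟨κ, ⟨⟨hleft, hright⟩, havoid⟩, hκ : 0 < κ⟩ :=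
    ((((hleft.and (hneg.eventually hright)).filter_mono nhdsWithin_le_nhds).and havoid).and
      self_mem_nhdsWithin).exists
  rw [parallel_swap, neg_neg, neg_mul_neg] at hright
  have hiff : 0 ≤ s * κ ↔ 0 ≤ s' * κ := hleft.symm.trans
    ((P.parallel_mem_region_iff (by linarith [hτ₀.2, hτ₁.2]) hκ.ne' havoid).trans hright)
  rw [mul_nonneg_iff_of_pos_right hκ, mul_nonneg_iff_of_pos_right hκ] at hiff
  rcases h.2.2.1 with rfl | rfl <;> rcases h'.2.2.1 with rfl | rfl <;>
    first | rfl | norm_num at hiff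

theorem exists_orientation : ∃ s : ℝ, (s = 1 ∨ s = -1) ∧ ∀ i, IsOrientedAngle P.region
    (P.vertex i) (P.vertex (i + 1)) (P.vertex (i - 1)) (P.angle i) s := by
  have := P.neZero
  choose s hs using fun i => (P.isInteriorAngle i).exists_oriented
  have hnat (k : ℕ) : s (k : ZMod n) = s 0 := by
    induction k with
    | zero => rw [Nat.cast_zero]
    | succ k ih => rw [Nat.cast_succ, ← P.orientation_eq_of_next (hs _) (hs _), ih]
  have hconst (i : ZMod n) : s i = s 0 := by rw [← hnat i.val, ZMod.natCast_zmod_val]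
  exact ⟨s 0, (hs 0).2.2.1, fun i => hconst i ▸ hs i⟩

end SphericalPolygon

/-! ### Spherical triangles and quadrilaterals -/

namespace Frame

variable {p u e : E3}

theorem inner_eq (h : Frame p u e) (v w : E3) :
    ⟪v, w⟫ = ⟪p, v⟫ * ⟪p, w⟫ + ⟪u, v⟫ * ⟪u, w⟫ + ⟪e, v⟫ * ⟪e, w⟫ := by
  conv_lhs => rw [h.expand v]
  simp only [inner_add_left, inner_smul_left, RCLike.conj_to_real]

theorem det3_eq (h : Frame p u e) {s : ℝ} (hs : cross3 p u = s • e) (v w : E3) :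
    det3 p v w = s * (⟪u, v⟫ * ⟪e, w⟫ - ⟪e, v⟫ * ⟪u, w⟫) := by
  have he : cross3 p e = -s • u := by
    have hd := h.cross3_dir hs (π / 2 : ℝ)
    rwa [← Real.Angle.coe_add, add_halves, dir_coe, dir_coe, Real.cos_pi_div_two,
      Real.sin_pi_div_two, Real.cos_pi, Real.sin_pi, zero_smul, one_smul, zero_smul, zero_add,
      add_zero, smul_smul, mul_neg_one] at hd
  rw [det3, h.expand v, map_add, map_add, map_smul, map_smul, map_smul, cross3_self, hs, he]
  simp only [← h.expand v, inner_add_left, inner_smul_left, smul_zero, inner_zero_left,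
    RCLike.conj_to_real]
  ring

theorem sq_add_sq_eq {p : S2} {u e : E3} (h : Frame (p : E3) u e) (q : S2) :
    ⟪u, (q : E3)⟫ ^ 2 + ⟪e, (q : E3)⟫ ^ 2 = 1 - ⟪(p : E3), q⟫ ^ 2 := by
  linear_combination S2.inner_self q - h.inner_eq (q : E3) q

theorem exists_inner_of_sees {p q : S2} {u e : E3} (h : Frame (p : E3) u e) {φ : Real.Angle}
    (hq : Sees p q (dir u e φ)) : ∃ b : ℝ, 0 < b ∧ b ^ 2 = 1 - ⟪(p : E3), q⟫ ^ 2 ∧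
      ⟪u, (q : E3)⟫ = b * φ.cos ∧ ⟪e, (q : E3)⟫ = b * φ.sin := by
  obtain ⟨a, b, hb, hq⟩ := hq
  have hcos : ⟪u, (q : E3)⟫ = b * φ.cos := by
    simp only [hq, dir, inner_add_right, inner_smul_right, h.up, h.uu, h.ue]
    ring
  have hsin : ⟪e, (q : E3)⟫ = b * φ.sin := by
    simp only [hq, dir, inner_add_right, inner_smul_right, h.ep, h.eu, h.ee]
    ring
  refine ⟨b, hb, ?_, hcos, hsin⟩
  rw [← h.sq_add_sq_eq q, hcos, hsin]
  linear_combination -b ^ 2 * φ.cos_sq_add_sin_sq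

theorem exists_of_inner_self {p : E3} (hp : ⟪p, p⟫ = 1) : ∃ u, Frame p u (cross3 p u) := by
  have hp0 : p ≠ 0 := inner_self_ne_zero.1 (hp ▸ one_ne_zero)
  have hfinrank : 0 < Module.finrank ℝ (ℝ ∙ p)ᗮ := by
    have hadd := (ℝ ∙ p).finrank_add_finrank_orthogonal
    rw [finrank_euclideanSpace_fin, finrank_span_singleton hp0] at hadd
    omega
  have : Nontrivial (ℝ ∙ p)ᗮ := Module.finrank_pos_iff.1 hfinrank
  obtain ⟨u, hu⟩ := exists_norm_eq (ℝ ∙ p)ᗮ zero_le_one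
  refine ⟨u, of_cross3 hp ?_ (Submodule.mem_orthogonal_singleton_iff_inner_right.1 u.2)⟩
  rw [real_inner_self_eq_norm_sq, ← Submodule.coe_norm, hu, one_pow]

end Frame

/-- In the oriented tangent plane at `p`, identified with the complex plane, the points `q` and
`r` have coordinates `ζ_q` and `ζ_r`; this is the number `conj ζ_q * ζ_r`, whose argument is the
angle at `p` from `q` to `r`. -/
noncomputable def cornerNumber (p q r : S2) : ℂ :=
  ⟨⟪(q : E3), r⟫ - ⟪(p : E3), q⟫ * ⟪(p : E3), r⟫, det3 p q r⟩

theorem Frame.cornerNumber_eq {p : S2} {u : E3} (h : Frame (p : E3) u (cross3 p u)) (q r : S2) :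
    cornerNumber p q r = ⟨⟪u, (q : E3)⟫, -⟪cross3 p u, (q : E3)⟫⟩ *
      ⟨⟪u, (r : E3)⟫, ⟪cross3 p u, (r : E3)⟫⟩ := by
  refine Complex.ext ?_ ?_
  · rw [cornerNumber, h.inner_eq (q : E3) r, Complex.mul_re]
    ring
  · rw [cornerNumber, h.det3_eq (one_smul ℝ _).symm, Complex.mul_im]
    ring

theorem cornerNumber_mul (p q r t : S2) : cornerNumber p q r * cornerNumber p r t =
    (1 - ⟪(p : E3), r⟫ ^ 2 : ℝ) * cornerNumber p q t := by
  obtain ⟨u, h⟩ := Frame.exists_of_inner_self (S2.inner_self p)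
  rw [← h.sq_add_sq_eq r, h.cornerNumber_eq, h.cornerNumber_eq, h.cornerNumber_eq]
  refine Complex.ext ?_ ?_ <;> simp only [Complex.mul_re, Complex.mul_im, Complex.ofReal_re,
    Complex.ofReal_im] <;> ring

theorem norm_cornerNumber_sq (p q r : S2) : ‖cornerNumber p q r‖ ^ 2 =
    (1 - ⟪(p : E3), q⟫ ^ 2) * (1 - ⟪(p : E3), r⟫ ^ 2) := by
  obtain ⟨u, h⟩ := Frame.exists_of_inner_self (S2.inner_self p)
  rw [← h.sq_add_sq_eq q, ← h.sq_add_sq_eq r, h.cornerNumber_eq, Complex.sq_norm,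
    Complex.normSq_mul, Complex.normSq_mk, Complex.normSq_mk]
  ring

section Triangle

variable {p q r : S2}

theorem one_sub_inner_sq_pos (h : 0 < det3 p q r) : 0 < 1 - ⟪(p : E3), r⟫ ^ 2 := by
  have hle : ⟪(p : E3), r⟫ ^ 2 ≤ 1 := by
    have hcs := real_inner_mul_inner_self_le (p : E3) r
    rwa [S2.inner_self, S2.inner_self, mul_one, ← sq] at hcs
  refine (sub_nonneg.2 hle).lt_of_ne' fun h0 => h.ne' ?_
  have hn := norm_cornerNumber_sq p q r
  rw [h0, mul_zero, sq_eq_zero_iff, norm_eq_zero] at hn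
  exact congrArg Complex.im hn

theorem cornerNumber_ne_zero (h : 0 < det3 p q r) : cornerNumber p q r ≠ 0 :=
  fun h0 => h.ne' (congrArg Complex.im h0)

theorem arg_cornerNumber_pos (h : 0 < det3 p q r) : 0 < (cornerNumber p q r).arg :=
  (Complex.arg_nonneg_iff.2 h.le).lt_of_ne' fun h0 => h.ne' (Complex.arg_eq_zero_iff.1 h0).2

theorem arg_cornerNumber_lt_pi (h : 0 < det3 p q r) : (cornerNumber p q r).arg < π :=
  Complex.arg_lt_pi_iff.2 (Or.inr h.ne')

theorem norm_mul_cos_arg_add_arg {z w : ℂ} (hz : z ≠ 0) (hw : w ≠ 0) :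
    ‖z * w‖ * Real.cos (z.arg + w.arg) = (z * w).re := by
  rw [← Complex.norm_mul_cos_arg (z * w), ← Real.Angle.cos_coe, ← Real.Angle.cos_coe,
    Complex.arg_mul_coe_angle hz hw, Real.Angle.coe_add]

theorem re_cornerNumber_mul_add_neg (h : 0 < det3 p q r) :
    (cornerNumber p q r * cornerNumber q r p).re +
      (1 - ⟪(q : E3), p⟫ ^ 2) * (cornerNumber r p q).re < 0 := by
  have hq : det3 (q : E3) r p = det3 (p : E3) q r := (det3_cyclic _ _ _).symm
  have hc := one_sub_inner_sq_pos (hq ▸ h)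
  have hsq := norm_cornerNumber_sq p q r
  rw [Complex.sq_norm, cornerNumber, Complex.normSq_mk] at hsq
  rw [Complex.mul_re]
  simp only [cornerNumber, hq]
  rw [real_inner_comm (q : E3) (p : E3), real_inner_comm (r : E3) (p : E3),
    real_inner_comm (r : E3) (q : E3)] at *
  have hlt : ⟪(q : E3), p⟫ < 1 := by nlinarith
  have hD := mul_pos (sub_pos.2 hlt) (mul_pos h h)
  linear_combination hD - ⟪(q : E3), p⟫ * hsq

theorem pi_lt_arg_add_arg_add_arg (h : 0 < det3 p q r) : π <
    (cornerNumber p q r).arg + (cornerNumber q r p).arg + (cornerNumber r p q).arg := by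
  have hq : 0 < det3 (q : E3) r p := det3_cyclic (p : E3) q r ▸ h
  have hr : 0 < det3 (r : E3) p q := det3_cyclic (q : E3) r p ▸ hq
  have hc := one_sub_inner_sq_pos hq
  have hnorm : ‖cornerNumber p q r * cornerNumber q r p‖ =
      ‖cornerNumber r p q‖ * (1 - ⟪(q : E3), p⟫ ^ 2) := by
    rw [← sq_eq_sq₀ (norm_nonneg _) (by positivity), norm_mul, mul_pow, mul_pow,
      norm_cornerNumber_sq, norm_cornerNumber_sq, norm_cornerNumber_sq,
      real_inner_comm (q : E3) (p : E3), real_inner_comm (r : E3) (p : E3),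
      real_inner_comm (r : E3) (q : E3)]
    ring
  have hcos : Real.cos ((cornerNumber p q r).arg + (cornerNumber q r p).arg) <
      Real.cos (π - (cornerNumber r p q).arg) := by
    have hneg := re_cornerNumber_mul_add_neg h
    rw [← norm_mul_cos_arg_add_arg (cornerNumber_ne_zero h) (cornerNumber_ne_zero hq), hnorm,
      ← Complex.norm_mul_cos_arg (cornerNumber r p q)] at hneg
    rw [Real.cos_pi_sub, lt_neg_iff_add_neg]
    refine neg_of_mul_neg_right (a := ‖cornerNumber r p q‖ * (1 - ⟪(q : E3), p⟫ ^ 2)) ?_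
      (by positivity)
    linarith
  by_contra! hle
  exact hcos.not_ge (Real.cos_le_cos_of_nonneg_of_le_pi
    (add_pos (arg_cornerNumber_pos h) (arg_cornerNumber_pos hq)).le
    (sub_le_self _ (arg_cornerNumber_pos hr).le) (le_sub_iff_add_le.2 hle))

end Triangle

theorem eq_of_coe_angle_eq {θ φ : ℝ} (hθ : θ ∈ Set.Ioo 0 (2 * π)) (hφ : φ ∈ Set.Ioo 0 (2 * π))
    (h : (θ : Real.Angle) = φ) : θ = φ := by
  rcases lt_trichotomy θ φ with hlt | heq | hlt
  · exact absurd (by rw [Real.Angle.coe_sub, h, sub_self])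
      (coe_angle_ne_zero (sub_pos.2 hlt) (by linarith [hθ.1, hφ.2]))
  · exact heq
  · exact absurd (by rw [Real.Angle.coe_sub, h, sub_self])
      (coe_angle_ne_zero (sub_pos.2 hlt) (by linarith [hφ.1, hθ.2]))

namespace IsOrientedAngle

variable {R : Set S2} {p q r : S2} {θ s : ℝ}

theorem exists_inner_eq (h : IsOrientedAngle R p q r θ s) : ∃ b b' : ℝ, 0 < b ∧ 0 < b' ∧
    b ^ 2 = 1 - ⟪(p : E3), q⟫ ^ 2 ∧ b' ^ 2 = 1 - ⟪(p : E3), r⟫ ^ 2 ∧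
    ⟪(q : E3), r⟫ = ⟪(p : E3), q⟫ * ⟪(p : E3), r⟫ + b * b' * Real.cos θ ∧
    det3 p q r = s * (b * b' * Real.sin θ) := by
  obtain ⟨-, -, -, u, e, hf, hs, hq, hr, -⟩ := h
  obtain ⟨b, hb, hb2, hqu, hqe⟩ := hf.exists_inner_of_sees hq
  obtain ⟨b', hb', hb2', hru, hre⟩ := hf.exists_inner_of_sees hr
  rw [Real.Angle.cos_zero, mul_one] at hqu
  rw [Real.Angle.sin_zero, mul_zero] at hqe
  refine ⟨b, b', hb, hb', hb2, hb2', ?_, ?_⟩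
  · rw [hf.inner_eq (q : E3) r, hqu, hqe, hru, hre, Real.Angle.cos_coe]
    ring
  · rw [hf.det3_eq hs, hqu, hqe, hru, hre, Real.Angle.sin_coe]
    ring

theorem arg_cornerNumber (h : IsOrientedAngle R p q r θ 1) :
    ((cornerNumber p q r).arg : Real.Angle) = θ := by
  obtain ⟨b, b', hb, hb', -, -, hinner, hdet⟩ := h.exists_inner_eq
  rw [← Complex.arg_mul_cos_add_sin_mul_I_coe_angle (mul_pos hb hb') θ]
  congr 2
  refine Complex.ext ?_ ?_
  · simp [cornerNumber, hinner, Complex.cos_ofReal_re, Complex.sin_ofReal_im]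
  · simp [cornerNumber, hdet, Complex.cos_ofReal_im, Complex.sin_ofReal_re]

theorem eq_arg_cornerNumber (h : IsOrientedAngle R p q r θ 1) (hD : 0 < det3 p q r) :
    θ = (cornerNumber p q r).arg :=
  eq_of_coe_angle_eq ⟨h.1, h.2.1⟩
    ⟨arg_cornerNumber_pos hD, (arg_cornerNumber_lt_pi hD).trans (by linarith [Real.pi_pos])⟩
    h.arg_cornerNumber.symm

theorem det3_pos (h : IsOrientedAngle R p q r θ 1) (hθ : θ < π) : 0 < det3 p q r := by
  obtain ⟨b, b', hb, hb', -, -, -, hdet⟩ := h.exists_inner_eq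
  have hsin := Real.sin_pos_of_pos_of_lt_pi h.1 hθ
  rw [hdet]
  positivity

theorem eq_arg_add_arg {t : S2} (h : IsOrientedAngle R p q t θ 1) (hD : 0 < det3 p q r)
    (hD' : 0 < det3 p r t) : θ = (cornerNumber p q r).arg + (cornerNumber p r t).arg := by
  have h0 := arg_cornerNumber_pos hD
  have h0' := arg_cornerNumber_pos hD'
  have hlt := arg_cornerNumber_lt_pi hD
  have hlt' := arg_cornerNumber_lt_pi hD'
  refine eq_of_coe_angle_eq ⟨h.1, h.2.1⟩ ⟨by linarith, by linarith⟩ ?_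
  rw [← h.arg_cornerNumber, Real.Angle.coe_add, ← Complex.arg_mul_coe_angle
    (cornerNumber_ne_zero hD) (cornerNumber_ne_zero hD'), cornerNumber_mul,
    Complex.arg_real_mul _ (one_sub_inner_sq_pos hD)]

end IsOrientedAngle

theorem two_pi_lt_angle_sum {R : Set S2} {v₀ v₁ v₂ v₃ : S2} {θ₀ θ₁ θ₂ θ₃ : ℝ}
    (h₀ : IsOrientedAngle R v₀ v₁ v₃ θ₀ 1) (h₁ : IsOrientedAngle R v₁ v₂ v₀ θ₁ 1)
    (h₂ : IsOrientedAngle R v₂ v₃ v₁ θ₂ 1) (h₃ : IsOrientedAngle R v₃ v₀ v₂ θ₃ 1)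
    (hlt₁ : θ₁ < π) (hlt₃ : θ₃ < π) : 2 * π < θ₀ + θ₁ + θ₂ + θ₃ := by
  have hD₁ := h₁.det3_pos hlt₁
  have hD₃ := h₃.det3_pos hlt₃
  have hD₂ : 0 < det3 (v₂ : E3) v₀ v₁ := det3_cyclic (v₁ : E3) v₂ v₀ ▸ hD₁
  have hD₀ : 0 < det3 (v₀ : E3) v₂ v₃ := det3_cyclic (v₃ : E3) v₀ v₂ ▸ hD₃
  have hD₀' : 0 < det3 (v₀ : E3) v₁ v₂ := det3_cyclic (v₂ : E3) v₀ v₁ ▸ hD₂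
  have hD₂' : 0 < det3 (v₂ : E3) v₃ v₀ := det3_cyclic (v₀ : E3) v₂ v₃ ▸ hD₀
  have hsum := pi_lt_arg_add_arg_add_arg hD₁
  have hsum' := pi_lt_arg_add_arg_add_arg hD₃
  rw [h₀.eq_arg_add_arg hD₀' hD₀, h₁.eq_arg_cornerNumber hD₁, h₂.eq_arg_add_arg hD₂' hD₂,
    h₃.eq_arg_cornerNumber hD₃]
  linarith

theorem SphericalPolygon.HasEqualOppositeEdges.pi_lt_add {Q : SphericalPolygon 4} {x y β γ : ℝ}
    (hQ : Q.HasEqualOppositeEdges x y β γ) (hγ : γ < π) : π < β + γ := by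
  obtain ⟨-, -, -, -, -, h0, h1, h2, h3⟩ := hQ
  obtain ⟨s, hs, ho⟩ := Q.exists_orientation
  have o₀ : IsOrientedAngle Q.region (Q.vertex 0) (Q.vertex 1) (Q.vertex 3) β s := h0 ▸ ho 0
  have o₁ : IsOrientedAngle Q.region (Q.vertex 1) (Q.vertex 2) (Q.vertex 0) γ s := h1 ▸ ho 1
  have o₂ : IsOrientedAngle Q.region (Q.vertex 2) (Q.vertex 3) (Q.vertex 1) β s := h2 ▸ ho 2
  have o₃ : IsOrientedAngle Q.region (Q.vertex 3) (Q.vertex 0) (Q.vertex 2) γ s := h3 ▸ ho 3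
  rcases hs with rfl | rfl
  · linarith [two_pi_lt_angle_sum o₀ o₁ o₂ o₃ hγ hγ]
  · have hrev {p q r : S2} {θ : ℝ} (h : IsOrientedAngle Q.region p q r θ (-1)) :
        IsOrientedAngle Q.region p r q θ 1 := by simpa only [neg_neg] using h.symm
    linarith [two_pi_lt_angle_sum (hrev o₀) (hrev o₃) (hrev o₂) (hrev o₁) hγ hγ]

/-! ### Regular polygons -/

theorem eq_of_inner_eq_of_det3_eq {p q v w : E3} (hpq : cross3 p q ≠ 0) (hp : ⟪p, v⟫ = ⟪p, w⟫)
    (hq : ⟪q, v⟫ = ⟪q, w⟫) (hdet : det3 p q v = det3 p q w) : v = w := by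
  have hp0 : ⟪v - w, p⟫ = 0 := by rw [real_inner_comm, inner_sub_right, hp, sub_self]
  have hq0 : ⟪v - w, q⟫ = 0 := by rw [real_inner_comm, inner_sub_right, hq, sub_self]
  have hc0 : ⟪cross3 p q, v - w⟫ = 0 := by rw [inner_sub_right, ← det3, ← det3, hdet, sub_self]
  have hsq := inner_cross3_cross3 (v - w) (cross3 p q) (v - w) (cross3 p q)
  rw [cross3_cross3, hp0, hq0, hc0, zero_smul, zero_smul, sub_zero, inner_zero_left, mul_zero,
    sub_zero, eq_comm, mul_eq_zero, inner_self_eq_zero, inner_self_eq_zero] at hsq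
  exact sub_eq_zero.1 (hsq.resolve_right hpq)

theorem exists_unit_inner_eq_zero (v w : E3) : ∃ n : E3, ⟪n, n⟫ = 1 ∧ ⟪n, v⟫ = 0 ∧ ⟪n, w⟫ = 0 := by
  set K := Submodule.span ℝ (Set.range ![v, w])
  have hK : Module.finrank ℝ K ≤ 2 := finrank_range_le_card ![v, w]
  have hperp : Kᗮ ≠ ⊥ := by
    intro hbot
    have hsum := K.finrank_add_finrank_orthogonal
    rw [hbot, finrank_bot, finrank_euclideanSpace_fin] at hsum
    omega
  obtain ⟨n, hn, hn0⟩ := Submodule.exists_mem_ne_zero_of_ne_bot hperp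
  have horth (i : Fin 2) : ⟪‖n‖⁻¹ • n, ![v, w] i⟫ = 0 := by
    rw [real_inner_smul_left, Submodule.inner_left_of_mem_orthogonal
      (Submodule.subset_span (Set.mem_range_self i)) hn, mul_zero]
  refine ⟨‖n‖⁻¹ • n, ?_, horth 0, horth 1⟩
  rw [real_inner_self_eq_norm_sq, norm_smul, norm_inv, norm_norm,
    inv_mul_cancel₀ (norm_ne_zero_iff.2 hn0), one_pow]

/-- The point at the angle `φ` on the circle with centre `h • n` and radius `r` in the plane
orthogonal to `n`, where `f` and `e` span the directions of that plane. -/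
noncomputable def circlePoint (n f e : E3) (h r : ℝ) (φ : Real.Angle) : E3 :=
  h • n + r • dir f e φ

theorem circlePoint_neg (n f e : E3) (h r : ℝ) (φ : Real.Angle) :
    circlePoint n f e h r (-φ) = circlePoint n f (-e) h r φ := by
  simp only [circlePoint, dir, Real.Angle.cos_neg, Real.Angle.sin_neg, neg_smul, smul_neg]

namespace Frame

variable {n f e : E3} {h r : ℝ}

theorem inner_circlePoint (hf : Frame n f e) (φ ψ : Real.Angle) :
    ⟪circlePoint n f e h r φ, circlePoint n f e h r ψ⟫ = h ^ 2 + r ^ 2 * (φ - ψ).cos := by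
  simp only [circlePoint, inner_add_left, inner_add_right, inner_smul_left, inner_smul_right,
    hf.inner_dir, hf.inner_dir_dir, hf.pp, real_inner_comm n (dir _ _ _), RCLike.conj_to_real]
  ring

theorem cross3_dir_dir (hf : Frame n f e) {s : ℝ} (hs : cross3 n f = s • e) (φ ψ : Real.Angle) :
    cross3 (dir f e φ) (dir f e ψ) = (s * (ψ - φ).sin) • n := by
  have hfe : cross3 f e = s • n := by
    have hexp := hf.expand (cross3 f e)
    have hdet : ⟪n, cross3 f e⟫ = s := by
      rw [real_inner_comm, ← det3, ← det3_cyclic, det3, hs, inner_smul_left, hf.ee, mul_one,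
        RCLike.conj_to_real]
    rwa [hdet, inner_cross3_left, inner_cross3_right, zero_smul, zero_smul, add_zero,
      add_zero] at hexp
  simp only [dir, map_add, map_smul, LinearMap.add_apply, LinearMap.smul_apply, cross3_self, hfe,
    cross3_swap f e, sub_eq_add_neg, Real.Angle.sin_add, Real.Angle.sin_neg, Real.Angle.cos_neg]
  module

theorem det3_circlePoint (hf : Frame n f e) {s : ℝ} (hs : cross3 n f = s • e)
    (φ ψ χ : Real.Angle) :
    det3 (circlePoint n f e h r φ) (circlePoint n f e h r ψ) (circlePoint n f e h r χ) =
      s * h * r ^ 2 * ((ψ - φ).sin + (χ - ψ).sin + (φ - χ).sin) := by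
  have hcos (θ : Real.Angle) :
      ⟪dir f e (θ + (π / 2 : ℝ)), dir f e χ⟫ = (χ - θ).sin := by
    rw [hf.inner_dir_dir, add_sub_right_comm, Real.Angle.cos_add_pi_div_two, ← Real.Angle.sin_neg,
      neg_sub]
  simp only [det3, circlePoint, map_add, map_smul, LinearMap.add_apply, LinearMap.smul_apply,
    cross3_self, cross3_swap n (dir f e φ), hf.cross3_dir hs, hf.cross3_dir_dir hs, inner_add_left,
    inner_add_right, inner_smul_left, inner_smul_right, inner_neg_left, hcos, hf.pp, hf.inner_dir,
    real_inner_comm n (dir _ _ _), smul_zero, inner_zero_left, RCLike.conj_to_real,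
    ← neg_sub χ φ, Real.Angle.sin_neg]
  ring

theorem circlePoint_injective (hf : Frame n f e) (hr : 0 < r) :
    Function.Injective (circlePoint n f e h r) :=
  fun _ _ heq => (hf.polar_inj hr hr.le heq).2.2

theorem neg_right (hf : Frame n f e) : Frame n f (-e) :=
  ⟨hf.pp, hf.uu, by rw [inner_neg_neg, hf.ee], hf.pu, by rw [inner_neg_right, hf.pe, neg_zero],
    by rw [inner_neg_right, hf.ue, neg_zero]⟩

theorem exists_eq_circlePoint (hf : Frame n f e) (hr : 0 < r) {v : E3} (hn : ⟪n, v⟫ = h)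
    (hv : ⟪v, v⟫ = h ^ 2 + r ^ 2) : ∃ φ, v = circlePoint n f e h r φ := by
  have hperp : ⟪n, r⁻¹ • (v - h • n)⟫ = 0 := by
    rw [inner_smul_right, inner_sub_right, inner_smul_right, hf.pp, hn, mul_one, sub_self, mul_zero]
  have hunit : ⟪r⁻¹ • (v - h • n), r⁻¹ • (v - h • n)⟫ = 1 := by
    simp only [inner_smul_left, inner_smul_right, inner_sub_left, inner_sub_right, hv, hn, hf.pp,
      real_inner_comm n v, RCLike.conj_to_real]
    field_simp
    ring
  obtain ⟨φ, hφ⟩ := hf.exists_dir_eq hperp hunit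
  exact ⟨φ, by rw [circlePoint, ← hφ, smul_inv_smul₀ hr.ne', add_sub_cancel]⟩

end Frame

theorem exists_circlePoint_eq {p q t : S2} (hpq : p ≠ q) : ∃ (n f e : E3) (h r : ℝ)
    (φ ψ : Real.Angle), Frame n f e ∧ 0 < r ∧ (p : E3) = circlePoint n f e h r 0 ∧
      (q : E3) = circlePoint n f e h r φ ∧ (t : E3) = circlePoint n f e h r ψ := by
  obtain ⟨n, hn, hnq, hnt⟩ := exists_unit_inner_eq_zero ((q : E3) - p) (t - p)
  rw [inner_sub_right, sub_eq_zero] at hnq hnt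
  set h := ⟪n, (p : E3)⟫
  have hnorm (z : S2) (hz : ⟪n, (z : E3)⟫ = h) :
      ⟪(z : E3) - h • n, (z : E3) - h • n⟫ = 1 - h ^ 2 := by
    simp only [inner_sub_left, inner_sub_right, inner_smul_left, inner_smul_right, hz, hn,
      real_inner_comm n (z : E3), S2.inner_self, RCLike.conj_to_real]
    ring
  have hh1 : 0 < 1 - h ^ 2 := by
    refine (hnorm p rfl ▸ real_inner_self_nonneg).lt_of_ne fun h0 => hpq (Subtype.ext ?_)
    have hp0 := inner_self_eq_zero.1 ((hnorm p rfl).trans h0.symm)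
    have hq0 := inner_self_eq_zero.1 ((hnorm q hnq).trans h0.symm)
    exact (sub_eq_zero.1 hp0).trans (sub_eq_zero.1 hq0).symm
  set r := √(1 - h ^ 2)
  have hr : 0 < r := Real.sqrt_pos.2 hh1
  have hr2 : h ^ 2 + r ^ 2 = 1 := by rw [Real.sq_sqrt hh1.le, add_sub_cancel]
  set f := r⁻¹ • ((p : E3) - h • n) with hf
  have hF : Frame n f (cross3 n f) := by
    refine Frame.of_cross3 hn ?_ ?_
    · rw [inner_smul_left, inner_smul_right, hnorm p rfl, ← eq_sub_of_add_eq' hr2,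
        RCLike.conj_to_real, sq, inv_mul_cancel_left₀ hr.ne', inv_mul_cancel₀ hr.ne']
    · rw [inner_smul_right, inner_sub_right, inner_smul_right, hn, mul_one, sub_self, mul_zero]
  obtain ⟨φ, hφ⟩ := hF.exists_eq_circlePoint hr hnq ((S2.inner_self q).trans hr2.symm)
  obtain ⟨ψ, hψ⟩ := hF.exists_eq_circlePoint hr hnt ((S2.inner_self t).trans hr2.symm)
  refine ⟨n, f, cross3 n f, h, r, φ, ψ, hF, hr, ?_, hφ, hψ⟩
  rw [circlePoint, dir_zero, hf, smul_inv_smul₀ hr.ne', add_sub_cancel]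

theorem Frame.eq_circlePoint_nsmul {n f e : E3} {h r : ℝ} (hf : Frame n f e) {w : ℕ → E3}
    {a b d : ℝ} (ha : ∀ k, ⟪w k, w (k + 1)⟫ = a) (hb : ∀ k, ⟪w k, w (k + 2)⟫ = b)
    (hd : ∀ k, det3 (w k) (w (k + 1)) (w (k + 2)) = d) (hcross : ∀ k, cross3 (w k) (w (k + 1)) ≠ 0)
    {Ψ : Real.Angle} (h0 : w 0 = circlePoint n f e h r 0) (h1 : w 1 = circlePoint n f e h r Ψ)
    (h2 : w 2 = circlePoint n f e h r (2 • Ψ)) (k : ℕ) : w k = circlePoint n f e h r (k • Ψ) := by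
  obtain ⟨s, -, hs⟩ := hf.cross3_eq_smul
  suffices hpair : ∀ k : ℕ, w k = circlePoint n f e h r (k • Ψ) ∧
      w (k + 1) = circlePoint n f e h r ((k + 1) • Ψ) from (hpair k).1
  intro k
  induction k with
  | zero => exact ⟨by rw [h0, zero_nsmul], by rw [zero_add, h1, one_nsmul]⟩
  | succ k ih =>
    obtain ⟨hk, hk1⟩ := ih
    refine ⟨hk1, eq_of_inner_eq_of_det3_eq (hcross k) ?_ ?_ ?_⟩
    · rw [hb k, ← hb 0, h0, h2, hk, hf.inner_circlePoint, hf.inner_circlePoint, zero_sub,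
        ← sub_add_cancel_left (k • Ψ) (2 • Ψ), ← add_nsmul]
    · rw [ha (k + 1), ← ha k, hk, hk1, hf.inner_circlePoint, hf.inner_circlePoint]
      simp only [add_nsmul, one_nsmul, sub_add_cancel_left]
    · rw [hd k, ← hd 0, h0, h1, h2, hk, hk1, hf.det3_circlePoint hs, hf.det3_circlePoint hs]
      simp only [add_nsmul, one_nsmul, two_nsmul, sub_zero, zero_sub, add_sub_cancel_left,
        add_sub_add_left_eq_sub, add_assoc, sub_add_cancel_left]

theorem exists_circlePoint_nat_mul_eq {w : ℕ → S2} {a b d : ℝ}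
    (ha : ∀ k, ⟪(w k : E3), w (k + 1)⟫ = a) (hb : ∀ k, ⟪(w k : E3), w (k + 2)⟫ = b)
    (hd : ∀ k, det3 (w k) (w (k + 1)) (w (k + 2)) = d)
    (hcross : ∀ k, cross3 (w k : E3) (w (k + 1)) ≠ 0) (hne : w 0 ≠ w 1) (hne' : w 0 ≠ w 2) :
    ∃ (n f e : E3) (h r ψ : ℝ), Frame n f e ∧ 0 < r ∧ 0 < ψ ∧ ψ < π ∧
      ∀ k : ℕ, (w k : E3) = circlePoint n f e h r (k * ψ : ℝ) := by
  obtain ⟨n, f, e, h, r, Ψ, Ψ', hf, hr, h0, h1, h2⟩ := exists_circlePoint_eq (t := w 2) hne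
  have hΨ' : Ψ' ≠ 0 := by
    rintro rfl
    exact hne' (Subtype.ext (h0.trans h2.symm))
  have hΨ : Ψ' = 2 • Ψ := by
    have hcos := (ha 1).trans (ha 0).symm
    rw [h0, h1, h2, hf.inner_circlePoint, hf.inner_circlePoint, add_right_inj,
      mul_right_inj' (pow_pos hr 2).ne', Real.Angle.cos_eq_iff_eq_or_eq_neg, zero_sub, neg_neg,
      sub_eq_self, or_iff_left hΨ', sub_eq_iff_eq_add, eq_neg_add_iff_add_eq] at hcos
    rw [two_nsmul, hcos]
  have hw := hf.eq_circlePoint_nsmul (w := fun k => (w k : E3)) ha hb hd hcross h0 h1 (hΨ ▸ h2)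
  have hΨ0 : Ψ.toReal ≠ 0 := by
    rw [Ne, Real.Angle.toReal_eq_zero_iff]
    rintro rfl
    exact hΨ' (hΨ.trans (smul_zero _))
  have hΨπ : Ψ.toReal ≠ π := by
    rw [Ne, Real.Angle.toReal_eq_pi_iff]
    rintro rfl
    exact hΨ' (hΨ.trans Real.Angle.two_nsmul_coe_pi)
  rcases hΨ0.lt_or_gt with hneg | hpos
  · refine ⟨n, f, -e, h, r, -Ψ.toReal, hf.neg_right, hr, neg_pos.2 hneg,
      neg_lt.2 Ψ.neg_pi_lt_toReal, fun k => ?_⟩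
    rw [hw, ← circlePoint_neg, mul_neg, Real.Angle.coe_neg, neg_neg,
      Real.Angle.natCast_mul_eq_nsmul, Real.Angle.coe_toReal]
  · refine ⟨n, f, e, h, r, Ψ.toReal, hf, hr, hpos, Ψ.toReal_le_pi.lt_of_ne hΨπ, fun k => ?_⟩
    rw [hw, Real.Angle.natCast_mul_eq_nsmul, Real.Angle.coe_toReal]

theorem sin_smul_circlePoint_add (n f e : E3) (h r ψ δ : ℝ) :
    Real.sin ((ψ - δ) / 2) • circlePoint n f e h r 0 +
      Real.sin ((ψ + δ) / 2) • circlePoint n f e h r ψ =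
      Real.sin ((ψ + δ) / 2) • circlePoint n f e h r δ +
        Real.sin ((ψ - δ) / 2) • circlePoint n f e h r (δ + ψ : ℝ) := by
  obtain ⟨A, hA⟩ : ∃ A, A = (ψ + δ) / 2 := ⟨_, rfl⟩
  obtain ⟨B, hB⟩ : ∃ B, B = (ψ - δ) / 2 := ⟨_, rfl⟩
  rw [← hA, ← hB]
  obtain rfl : ψ = A + B := by linarith
  obtain rfl : δ = A - B := by linarith
  rw [show A - B + (A + B) = A + A by ring]
  simp only [circlePoint, dir_zero, dir_coe, Real.cos_add, Real.cos_sub, Real.sin_add,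
    Real.sin_sub]
  linear_combination (norm := module) Real.sin_sq_add_cos_sq A • (-(r * Real.sin B)) • f

theorem arc_inter_arc_nonempty {n f e : E3} {h r ψ δ : ℝ} {p q p' q' : S2} (hδ : 0 < δ)
    (hδψ : δ < ψ) (hψ : ψ < π) (hpq : p ≠ -q) (hp : (p : E3) = circlePoint n f e h r 0)
    (hq : (q : E3) = circlePoint n f e h r ψ) (hp' : (p' : E3) = circlePoint n f e h r δ)
    (hq' : (q' : E3) = circlePoint n f e h r (δ + ψ : ℝ)) : (arc p q ∩ arc p' q').Nonempty := by
  have hA : 0 < Real.sin ((ψ + δ) / 2) :=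
    Real.sin_pos_of_pos_of_lt_pi (by linarith) (by linarith)
  have hB : 0 < Real.sin ((ψ - δ) / 2) :=
    Real.sin_pos_of_pos_of_lt_pi (by linarith) (by linarith)
  have hsum := sin_smul_circlePoint_add n f e h r ψ δ
  rw [← hp, ← hq, ← hp', ← hq'] at hsum
  have hne := nonneg_comb_ne_zero hpq hB.le hA.le (by positivity)
  refine ⟨_, toSphere_mem_arc hB.le hA.le hne, ?_⟩
  rw [hsum] at hne ⊢
  exact toSphere_mem_arc hA.le hB.le hne

namespace SphericalPolygon

variable {m : ℕ} {P : SphericalPolygon m}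

theorem natCast_eq_natCast {a b : ℕ} (ha : a < m) (hb : b < m)
    (h : (a : ZMod m) = (b : ZMod m)) : a = b :=
  ((ZMod.natCast_eq_natCast_iff a b m).1 h).eq_of_lt_of_lt ha hb

theorem le_of_coe_angle_eq {n f e : E3} {h r ψ : ℝ} (hψπ : ψ < π)
    (hv : ∀ k : ℕ, (P.vertex k : E3) = circlePoint n f e h r (k * ψ : ℝ)) {j : ℕ} (hj : 1 < j)
    (hjm : j + 1 < m) {δ : ℝ} (hδ : 0 ≤ δ) (hjδ : ((j * ψ : ℝ) : Real.Angle) = δ) : ψ ≤ δ := by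
  have hv0 : (P.vertex 0 : E3) = circlePoint n f e h r 0 := by simpa using hv 0
  have hv1 : (P.vertex (0 + 1) : E3) = circlePoint n f e h r ψ := by simpa using hv 1
  have hvj := hv j
  have hvj1 : (P.vertex (j + 1) : E3) = circlePoint n f e h r (δ + ψ : ℝ) := by
    rw [Real.Angle.coe_add, ← hjδ, ← Real.Angle.coe_add, ← add_one_mul, ← Nat.cast_add_one,
      ← Nat.cast_add_one, hv]
  rw [hjδ] at hvj
  have hj0 : (j : ZMod m) ≠ 0 := fun h0 =>
    (zero_lt_one.trans hj).ne' (natCast_eq_natCast (by omega) (by omega)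
      (h0.trans Nat.cast_zero.symm))
  by_contra! hlt
  rcases hδ.eq_or_lt with rfl | hpos
  · exact hj0 (P.vertex_injective (Subtype.ext (hvj.trans hv0.symm)))
  · obtain ⟨z, hz, hz'⟩ := arc_inter_arc_nonempty hpos hlt hψπ (P.vertex_ne_neg 0) hv0 hv1 hvj hvj1
    refine Set.disjoint_left.1 (P.edge_disjoint 0 j hj0.symm (fun h1 => ?_) fun h1 => ?_) hz hz'
    · exact hj.ne' (natCast_eq_natCast (m := m) (by omega) (by omega) (by simpa using h1))
    · exact j.succ_ne_zero (natCast_eq_natCast hjm (by omega) (by simpa using h1.symm))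

/-- Vertices that run around a circle by equal steps do so only once, as otherwise the first edge
would meet the one that starts after the first full turn. -/
theorem mul_eq_two_pi {n f e : E3} {h r ψ : ℝ} (hf : Frame n f e) (hr : 0 < r) (hψ : 0 < ψ)
    (hψπ : ψ < π) (hv : ∀ k : ℕ, (P.vertex k : E3) = circlePoint n f e h r (k * ψ : ℝ)) :
    m * ψ = 2 * π := by
  have hm : (0 : ℝ) < m := by exact_mod_cast three_pos.trans_le P.three_le
  obtain ⟨k, hk⟩ : ∃ k : ℤ, m * ψ - 0 = 2 * π * k :=
    Real.Angle.angle_eq_iff_two_pi_dvd_sub.1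
      (hf.circlePoint_injective (h := h) hr
        (by rw [← hv, ZMod.natCast_self, ← Nat.cast_zero, hv, Nat.cast_zero, zero_mul]))
  rw [sub_zero] at hk
  have hk0 : 0 < k := by
    have hpos : 0 < 2 * π * k := hk ▸ mul_pos hm hψ
    exact_mod_cast pos_of_mul_pos_right hpos Real.two_pi_pos.le
  suffices hk1 : k < 2 by
    rw [hk, show k = 1 by omega, Int.cast_one, mul_one]
  by_contra! hk2
  have hturns : 4 * π ≤ m * ψ := by
    have hk2' : (2 : ℝ) ≤ k := by exact_mod_cast hk2
    nlinarith [Real.pi_pos]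
  have hle : 2 * π ≤ ⌈2 * π / ψ⌉₊ * ψ := (div_le_iff₀ hψ).1 (Nat.le_ceil _)
  have hlt : ⌈2 * π / ψ⌉₊ * ψ < 2 * π + ψ := by
    have hceil := Nat.ceil_lt_add_one (div_pos Real.two_pi_pos hψ).le
    rwa [← lt_div_iff₀ hψ, add_div, div_self hψ.ne']
  have hj : 1 < ⌈2 * π / ψ⌉₊ := by
    rw [Nat.lt_ceil, Nat.cast_one, lt_div_iff₀ hψ]
    linarith
  have hjm : ⌈2 * π / ψ⌉₊ + 1 < m := by
    have hmul : (⌈2 * π / ψ⌉₊ + 1 : ℝ) * ψ < m * ψ := by linarith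
    exact_mod_cast lt_of_mul_lt_mul_right hmul hψ.le
  have hδ := le_of_coe_angle_eq hψπ hv hj hjm (sub_nonneg.2 hle)
    (Real.Angle.angle_eq_iff_two_pi_dvd_sub.2 ⟨1, by push_cast; ring⟩)
  linarith

theorem inner_vertex_vertex_add_one (P : SphericalPolygon m) (i : ZMod m) :
    ⟪(P.vertex i : E3), P.vertex (i + 1)⟫ = Real.cos (P.edgeLength i) := by
  rw [edgeLength, InnerProductGeometry.cos_angle, norm_eq_of_mem_sphere, norm_eq_of_mem_sphere,
    mul_one, div_one]

/-- The law of cosines, applied to the triangle that is cut off by a short diagonal. -/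
theorem IsRegular.exists_inner_eq {x α : ℝ} (hP : P.IsRegular x α) : ∃ s : ℝ, ∀ i,
    ⟪(P.vertex i : E3), P.vertex (i + 2)⟫ =
      Real.cos x ^ 2 + (1 - Real.cos x ^ 2) * Real.cos α ∧
    det3 (P.vertex i) (P.vertex (i + 1)) (P.vertex (i + 2)) =
      s * ((1 - Real.cos x ^ 2) * Real.sin α) ∧ 0 < 1 - Real.cos x ^ 2 := by
  obtain ⟨s, -, hs⟩ := P.exists_orientation
  refine ⟨s, fun i => ?_⟩
  have hcorner := hs (i + 1)
  rw [hP.2, add_sub_cancel_right, add_assoc, one_add_one_eq_two] at hcorner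
  have hleft : ⟪(P.vertex (i + 1) : E3), P.vertex i⟫ = Real.cos x := by
    rw [real_inner_comm, inner_vertex_vertex_add_one, hP.1]
  have hright := P.inner_vertex_vertex_add_one (i + 1)
  rw [hP.1, add_assoc, one_add_one_eq_two] at hright
  obtain ⟨b, b', hb, hb', hb2, hb2', hinner, hdet⟩ := hcorner.exists_inner_eq
  rw [hleft] at hb2'
  rw [hright] at hb2
  obtain rfl : b = b' := (sq_eq_sq₀ hb.le hb'.le).1 (hb2.trans hb2'.symm)
  rw [hleft, hright, ← sq, ← sq, real_inner_comm] at hinner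
  rw [← det3_cyclic, ← sq] at hdet
  rw [← hb2]
  exact ⟨hinner, hdet, pow_pos hb 2⟩

theorem IsRegular.exists_circlePoint {x α : ℝ} (hP : P.IsRegular x α) :
    ∃ (n f e : E3) (h r ψ : ℝ), Frame n f e ∧ 0 < r ∧ 0 < ψ ∧ ψ < π ∧
      ∀ k : ℕ, (P.vertex k : E3) = circlePoint n f e h r (k * ψ : ℝ) := by
  obtain ⟨s, hs⟩ := hP.exists_inner_eq
  have hm := P.three_le
  have hne {k : ℕ} (hk0 : 0 < k) (hk : k < m) : P.vertex (0 : ℕ) ≠ P.vertex k := fun h =>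
    hk0.ne (natCast_eq_natCast (hk0.trans hk) hk (P.vertex_injective h))
  refine exists_circlePoint_nat_mul_eq (w := fun k => P.vertex k) (a := Real.cos x)
    (b := Real.cos x ^ 2 + (1 - Real.cos x ^ 2) * Real.cos α)
    (d := s * ((1 - Real.cos x ^ 2) * Real.sin α)) (fun k => ?_) (fun k => ?_) (fun k => ?_)
    (fun k => ?_) (hne one_pos (by omega)) (hne two_pos (by omega))
  · rw [Nat.cast_add_one, inner_vertex_vertex_add_one, hP.1]
  · rw [Nat.cast_add, Nat.cast_ofNat, (hs k).1]
  · rw [Nat.cast_add_one, Nat.cast_add, Nat.cast_ofNat, (hs k).2.1]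
  · rw [Nat.cast_add_one]
    exact P.cross3_vertex_ne_zero k

theorem pi_sub_lt_of_one_add_mul_eq {α ψ c : ℝ} (hα : 0 < α) (hαπ : α ≤ π) (hψ : 0 < ψ)
    (hc : c < 1) (h : (1 + c) * (1 - Real.cos α) = 2 * (1 + Real.cos ψ)) : π - α < ψ := by
  have hcosα : Real.cos α < 1 := by
    simpa using Real.cos_lt_cos_of_nonneg_of_le_pi le_rfl hαπ hα
  have hlt : Real.cos ψ < Real.cos (π - α) := by
    rw [Real.cos_pi_sub]
    nlinarith
  by_contra! hle
  exact hlt.not_ge (Real.cos_le_cos_of_nonneg_of_le_pi hψ.le (by linarith) hle)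

theorem IsRegular.angle_gt {x α : ℝ} (hP : P.IsRegular x α) : (m - 2) * π < m * α := by
  have hm : (0 : ℝ) < m := by exact_mod_cast three_pos.trans_le P.three_le
  have hα : 0 < α := hP.2 0 ▸ (P.isInteriorAngle 0).1
  rcases le_or_gt π α with hπα | hαπ
  · nlinarith [Real.pi_pos]
  obtain ⟨n, f, e, h, r, ψ, hf, hr, hψ, hψπ, hv⟩ := hP.exists_circlePoint
  have hturn := mul_eq_two_pi hf hr hψ hψπ hv
  obtain ⟨s, hs⟩ := hP.exists_inner_eq
  obtain ⟨hinner2, -, hc⟩ := hs 0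
  have hinner (k : ℕ) :
      ⟪(P.vertex (0 : ℕ) : E3), P.vertex k⟫ = h ^ 2 + r ^ 2 * Real.cos (k * ψ) := by
    rw [hv, hv, hf.inner_circlePoint, ← Real.Angle.coe_sub, Real.Angle.cos_coe, Nat.cast_zero,
      zero_mul, zero_sub, Real.cos_neg]
  have h0 : 1 = h ^ 2 + r ^ 2 := by simpa [S2.inner_self] using hinner 0
  have h1 : Real.cos x = h ^ 2 + r ^ 2 * Real.cos ψ := by
    rw [← hP.1 0, ← inner_vertex_vertex_add_one]
    simpa using hinner 1
  have h2 : Real.cos x ^ 2 + (1 - Real.cos x ^ 2) * Real.cos α =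
      h ^ 2 + r ^ 2 * (2 * Real.cos ψ ^ 2 - 1) := by
    rw [← hinner2, ← Real.cos_two_mul]
    simpa using hinner 2
  have hx : 0 < 1 - Real.cos x := by nlinarith
  have hsides : (1 + Real.cos x) * (1 - Real.cos α) = 2 * (1 + Real.cos ψ) := by
    refine mul_left_cancel₀ hx.ne' ?_
    linear_combination h0 - h2 - 2 * (1 + Real.cos ψ) * (h0 - h1)
  have hψα := pi_sub_lt_of_one_add_mul_eq hα hαπ.le hψ (sub_pos.1 hx) hsides
  nlinarith

end SphericalPolygon

/-! ### Regular polygons and quadrilaterals as tiles -/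

/-- The spherical distance of two points. -/
noncomputable def S2.sphDist (p q : S2) : ℝ := InnerProductGeometry.angle (p : E3) (q : E3)

namespace SphericalPolygon

variable {n k : ℕ} {P : SphericalPolygon n} {P' : SphericalPolygon k} {x y α β γ : ℝ}

theorem IsRegular.congr (hP : P.IsRegular x α) (h : P.Congruent P') : P'.IsRegular x α := by
  obtain ⟨σ, hangle, hedge | hedge⟩ := h.exists_equiv
  · exact ⟨fun i => (hedge i).2.trans (hP.1 _), fun i => (hangle i).trans (hP.2 _)⟩
  · exact ⟨fun i => (hedge i).2.trans (hP.1 _), fun i => (hangle i).trans (hP.2 _)⟩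

theorem IsRegular.sphDist_eq (hP : P.IsRegular x α) {i i' : ZMod n} (h : IsNext i i') :
    S2.sphDist (P.vertex i) (P.vertex i') = x := by
  rcases h with rfl | rfl
  · exact hP.1 i
  · have hx := hP.1 (i - 1)
    rw [edgeLength, sub_add_cancel] at hx
    exact (InnerProductGeometry.angle_comm _ _).trans hx

/-- The edges have alternatingly the lengths `x` and `y`, and the angles are alternatingly
`β` and `γ`. In contrast to `HasEqualOppositeEdges`, this is invariant under congruence. -/
def Alternates (P : SphericalPolygon n) (x y β γ : ℝ) : Prop :=
  ∀ i, ((P.angle i = β ∧ P.angle (i + 1) = γ) ∨ (P.angle i = γ ∧ P.angle (i + 1) = β)) ∧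
    ((P.edgeLength i = x ∧ P.edgeLength (i + 1) = y) ∨
      (P.edgeLength i = y ∧ P.edgeLength (i + 1) = x))

theorem HasEqualOppositeEdges.alternates {Q : SphericalPolygon 4}
    (hQ : Q.HasEqualOppositeEdges x y β γ) : Q.Alternates x y β γ := by
  obtain ⟨-, l0, l1, l2, l3, a0, a1, a2, a3⟩ := hQ
  have hsucc : (0 : ZMod 4) + 1 = 1 ∧ (1 : ZMod 4) + 1 = 2 ∧ (2 : ZMod 4) + 1 = 3 ∧
    (3 : ZMod 4) + 1 = 0 := by decide
  intro i
  obtain rfl | rfl | rfl | rfl : i = 0 ∨ i = 1 ∨ i = 2 ∨ i = 3 := by revert i; decide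
  all_goals simp [hsucc, l0, l1, l2, l3, a0, a1, a2, a3]

namespace Alternates

theorem angle_of_isNext (hP : P.Alternates x y β γ) {i i' : ZMod n} (h : IsNext i i') :
    (P.angle i = β ∧ P.angle i' = γ) ∨ (P.angle i = γ ∧ P.angle i' = β) := by
  rcases h with rfl | rfl
  · exact (hP i).1
  · have hprev := (hP (i - 1)).1
    rw [sub_add_cancel] at hprev
    exact hprev.symm.imp And.symm And.symm

theorem congr (hP : P.Alternates x y β γ) (h : P.Congruent P') : P'.Alternates x y β γ := by
  obtain ⟨σ, hangle, hedge⟩ := h.exists_equiv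
  intro i
  rw [hangle, hangle]
  rcases hedge with hedge | hedge
  · rw [(hedge i).2, (hedge (i + 1)).2, (hedge i).1]
    exact hP (σ i)
  · rw [(hedge i).2, (hedge (i + 1)).2, (hedge i).1]
    have hside := (hP (σ i - 1 - 1)).2
    rw [sub_add_cancel] at hside
    exact ⟨hP.angle_of_isNext (Or.inr rfl), hside.symm.imp And.symm And.symm⟩

theorem sphDist (hP : P.Alternates x y β γ) (i : ZMod n) :
    (S2.sphDist (P.vertex i) (P.vertex (i + 1)) = x ∧
      S2.sphDist (P.vertex i) (P.vertex (i - 1)) = y) ∨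
    (S2.sphDist (P.vertex i) (P.vertex (i + 1)) = y ∧
      S2.sphDist (P.vertex i) (P.vertex (i - 1)) = x) := by
  have hside := (hP (i - 1)).2
  rw [sub_add_cancel, edgeLength, edgeLength, sub_add_cancel,
    InnerProductGeometry.angle_comm] at hside
  exact hside.symm.imp And.symm And.symm

theorem not_isRegular (hP : P.Alternates x y β γ) (hxy : x ≠ y) : ¬P.IsRegular x α := by
  rintro ⟨hedge, -⟩
  rcases (hP 0).2 with ⟨-, hy⟩ | ⟨hy, -⟩
  · exact hxy ((hedge _).symm.trans hy)
  · exact hxy ((hedge _).symm.trans hy)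

end Alternates

end SphericalPolygon

/-! ### Counting corners and edges at a vertex -/

namespace SphericalTiling

open SphericalPolygon

variable {T : SphericalTiling} {v : S2}

noncomputable instance : Fintype (T.cornersAt v) := Fintype.ofFinite _

namespace VertexArrangement

variable (A : T.VertexArrangement v)

theorem isNext_st (c : T.cornersAt v) : IsNext c.1.2 (A.st c) :=
  (A.st_en c).imp And.left And.left

theorem isNext_en (c : T.cornersAt v) : IsNext c.1.2 (A.en c) :=
  (A.st_en c).symm.imp And.right And.right

/-- The same corners in the opposite cyclic order. -/
def reverse : T.VertexArrangement v where
  next := A.next.symm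
  st := A.en
  en := A.st
  st_en c := (A.st_en c).symm.imp And.symm And.symm
  next_ne c h := A.next_ne c ((A.next.symm_apply_eq.1 h).symm)
  vertex_next c := by
    have h := A.vertex_next (A.next.symm c)
    rw [Equiv.apply_symm_apply] at h
    exact h.symm
  st_inj := A.en_inj
  en_inj := A.st_inj
  add_angle c h := by
    rw [Equiv.symm_apply_eq, Equiv.symm_apply_eq] at h
    have hnext : A.next.symm c = A.next c := A.next.symm_apply_eq.2 h
    rw [hnext]
    exact A.add_angle c h.symm
  sum_angle := A.sum_angle

theorem eq_next {c c' : T.cornersAt v} (hne : c' ≠ c) {i : ZMod (T.sides c'.1.1)}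
    (hi : IsNext c'.1.2 i) (h : (T.tile c'.1.1).vertex i = (T.tile c.1.1).vertex (A.en c)) :
    c' = A.next c := by
  obtain rfl | rfl : i = A.st c' ∨ i = A.en c' := by
    rcases A.st_en c' with ⟨hst, hen⟩ | ⟨hst, hen⟩ <;> rw [hst, hen]
    · exact hi
    · exact Or.symm hi
  · rw [A.vertex_next] at h
    exact A.st_inj _ _ h
  · exact absurd (A.en_inj _ _ h) hne

end VertexArrangement

theorem exists_vertexArrangement_st_en (c : T.cornersAt v) :
    ∃ A : T.VertexArrangement v, A.st c = c.1.2 - 1 ∧ A.en c = c.1.2 + 1 := by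
  obtain ⟨A⟩ := T.nonempty_vertexArrangement ⟨c.1, c.2⟩
  rcases A.st_en c with ⟨hst, hen⟩ | ⟨hst, hen⟩
  · exact ⟨A.reverse, hen, hst⟩
  · exact ⟨A, hst, hen⟩

theorem cornersAt_vertex_nonempty (k : Fin T.numTiles) (i : ZMod (T.sides k)) :
    (T.cornersAt ((T.tile k).vertex i)).Nonempty := ⟨⟨k, i⟩, rfl⟩

variable {m n : ℕ}

/-- The number of corners of copies of `P` at `v`. -/
noncomputable def numCorners (T : SphericalTiling) (P : SphericalPolygon n) (v : S2) : ℕ :=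
  {s ∈ T.cornersAt v | P.Congruent (T.tile s.1)}.ncard

/-- The number of corners with angle `θ` of copies of `Q` at `v`. -/
noncomputable def numAngles (T : SphericalTiling) (Q : SphericalPolygon n) (θ : ℝ) (v : S2) : ℕ :=
  {s ∈ T.cornersAt v | Q.Congruent (T.tile s.1) ∧ (T.tile s.1).angle s.2 = θ}.ncard

/-- The vertex `v` has type `α^a β^b γ^c`, as in `HasVertexOfType`. -/
abbrev IsOfType (T : SphericalTiling) (P : SphericalPolygon m) (Q : SphericalPolygon n)
    (β γ : ℝ) (v : S2) (a b c : ℕ) : Prop :=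
  T.numCorners P v = a ∧ T.numAngles Q β v = b ∧ T.numAngles Q γ v = c

/-- The points `p` and `q` are the ends of an edge of a copy of `Q`. -/
def HasEdge (T : SphericalTiling) (Q : SphericalPolygon n) (p q : S2) : Prop :=
  ∃ (l : Fin T.numTiles) (j j' : ZMod (T.sides l)), Q.Congruent (T.tile l) ∧ IsNext j j' ∧
    (T.tile l).vertex j = p ∧ (T.tile l).vertex j' = q

variable {P : SphericalPolygon m} {Q : SphericalPolygon n}

theorem HasEdge.symm {p q : S2} : T.HasEdge Q p q → T.HasEdge Q q p :=
  fun ⟨l, j, j', hl, hj, hp, hq⟩ => ⟨l, j', j, hl, hj.symm, hq, hp⟩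

theorem numCorners_pos {k : Fin T.numTiles} (hk : P.Congruent (T.tile k)) (i : ZMod (T.sides k)) :
    0 < T.numCorners P ((T.tile k).vertex i) :=
  (Set.ncard_pos (Set.toFinite _)).2 ⟨⟨k, i⟩, rfl, hk⟩

theorem numAngles_pos {θ : ℝ} {k : Fin T.numTiles} (hk : Q.Congruent (T.tile k))
    {i : ZMod (T.sides k)} (hi : (T.tile k).angle i = θ) :
    0 < T.numAngles Q θ ((T.tile k).vertex i) :=
  (Set.ncard_pos (Set.toFinite _)).2 ⟨⟨k, i⟩, rfl, hk, hi⟩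

theorem exists_vertex_eq_of_numCorners_pos (h : 0 < T.numCorners P v) :
    ∃ (k : Fin T.numTiles) (i : ZMod (T.sides k)),
      P.Congruent (T.tile k) ∧ (T.tile k).vertex i = v :=
  have ⟨⟨k, i⟩, hv, hk⟩ := (Set.ncard_pos (Set.toFinite _)).1 h
  ⟨k, i, hk, hv⟩

theorem eq_of_numCorners_eq_one (h : T.numCorners P v = 1) {c d : T.cornersAt v}
    (hc : P.Congruent (T.tile c.1.1)) (hd : P.Congruent (T.tile d.1.1)) : c = d :=
  Subtype.ext ((Set.ncard_le_one (Set.toFinite _)).1 h.le _ ⟨c.2, hc⟩ _ ⟨d.2, hd⟩)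

theorem exists_eq_of_numCorners_eq_two (h : T.numCorners P v = 2) {c : T.cornersAt v}
    (hc : P.Congruent (T.tile c.1.1)) :
    ∃ c' ≠ c, P.Congruent (T.tile c'.1.1) ∧
      ∀ d : T.cornersAt v, d ≠ c → P.Congruent (T.tile d.1.1) → d = c' := by
  have hmem : c.1 ∈ {s ∈ T.cornersAt v | P.Congruent (T.tile s.1)} := ⟨c.2, hc⟩
  have hcard : ({s ∈ T.cornersAt v | P.Congruent (T.tile s.1)} \ {c.1}).ncard = 1 := by
    rw [Set.ncard_sdiff_singleton_of_mem hmem, ← numCorners, h]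
  obtain ⟨s, hs⟩ := Set.ncard_eq_one.1 hcard
  obtain ⟨⟨hsv, hsP⟩, hsc⟩ := hs.ge (Set.mem_singleton s)
  refine ⟨⟨s, hsv⟩, fun h => hsc (congrArg Subtype.val h), hsP, fun d hd hdP => Subtype.ext ?_⟩
  rw [← Set.mem_singleton_iff (b := s), ← hs]
  exact ⟨⟨d.2, hdP⟩, fun h => hd (Subtype.ext h)⟩

theorem ncard_cornersAt_sep (p : (Σ k, ZMod (T.sides k)) → Prop) [DecidablePred p] :
    {s ∈ T.cornersAt v | p s}.ncard = ∑ s : T.cornersAt v, if p s.1 then 1 else 0 := by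
  have himage : {s ∈ T.cornersAt v | p s} = Subtype.val '' {s : T.cornersAt v | p s.1} :=
    (Subtype.image_preimage_coe (T.cornersAt v) {s | p s}).symm
  rw [himage, Set.ncard_image_of_injective _ Subtype.val_injective, Finset.sum_boole, Nat.cast_id,
    ← Set.ncard_coe_finset, Finset.coe_filter_univ]

end SphericalTiling

/-! ### Dihedral tilings by a regular polygon and a quadrilateral -/

namespace SphericalTiling

open SphericalPolygon

/-- An edge-to-edge dihedral tiling whose prototiles are a regular polygon and a quadrilateral
with equal opposite edges. -/
structure IsRegularQuadTiling {m : ℕ} (T : SphericalTiling) (P : SphericalPolygon m)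
    (Q : SphericalPolygon 4) (x y α β γ : ℝ) : Prop where
  regular : P.IsRegular x α
  quad : Q.HasEqualOppositeEdges x y β γ
  lt : γ < β
  dihedral : T.IsDihedral P Q

namespace IsRegularQuadTiling

variable {T : SphericalTiling} {v : S2} {m : ℕ} {P : SphericalPolygon m} {Q : SphericalPolygon 4}
  {x y α β γ : ℝ} (H : T.IsRegularQuadTiling P Q x y α β γ)
include H

theorem alternates {k : Fin T.numTiles} (hk : Q.Congruent (T.tile k)) :
    (T.tile k).Alternates x y β γ := H.quad.alternates.congr hk

theorem angle_eq {k : Fin T.numTiles} (hk : P.Congruent (T.tile k)) (i : ZMod (T.sides k)) :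
    (T.tile k).angle i = α := (H.regular.congr hk).2 i

theorem not_congruent {k : Fin T.numTiles} (hk : Q.Congruent (T.tile k)) :
    ¬P.Congruent (T.tile k) :=
  fun hP => (H.alternates hk).not_isRegular H.quad.1 (H.regular.congr hP)

theorem sphDist_of_regular {c : T.cornersAt v} (hc : P.Congruent (T.tile c.1.1))
    {i : ZMod (T.sides c.1.1)} (hi : IsNext c.1.2 i) :
    S2.sphDist v ((T.tile c.1.1).vertex i) = x := by
  have h := (H.regular.congr hc).sphDist_eq hi
  rwa [show (T.tile c.1.1).vertex c.1.2 = v from c.2] at h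

theorem sphDist_of_quad (A : T.VertexArrangement v) {c : T.cornersAt v}
    (hc : Q.Congruent (T.tile c.1.1)) :
    (S2.sphDist v ((T.tile c.1.1).vertex (A.st c)) = x ∧
      S2.sphDist v ((T.tile c.1.1).vertex (A.en c)) = y) ∨
    (S2.sphDist v ((T.tile c.1.1).vertex (A.st c)) = y ∧
      S2.sphDist v ((T.tile c.1.1).vertex (A.en c)) = x) := by
  have h := (H.alternates hc).sphDist c.1.2
  rw [show (T.tile c.1.1).vertex c.1.2 = v from c.2] at h
  rcases A.st_en c with ⟨hst, hen⟩ | ⟨hst, hen⟩ <;> rw [hst, hen]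
  · exact h
  · exact h.symm.imp And.symm And.symm

theorem corner_cases (s : Σ k, ZMod (T.sides k)) :
    P.Congruent (T.tile s.1) ∨ (Q.Congruent (T.tile s.1) ∧ (T.tile s.1).angle s.2 = β) ∨
      (Q.Congruent (T.tile s.1) ∧ (T.tile s.1).angle s.2 = γ) :=
  (H.dihedral.1 s.1).imp_right fun hQ =>
    ((H.alternates hQ s.2).1.imp And.left And.left).imp (And.intro hQ) (And.intro hQ)

theorem sum_corners {f : T.cornersAt v → ℝ} {a b c : ℝ}
    (ha : ∀ s : T.cornersAt v, P.Congruent (T.tile s.1.1) → f s = a)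
    (hb : ∀ s : T.cornersAt v, Q.Congruent (T.tile s.1.1) → (T.tile s.1.1).angle s.1.2 = β →
      f s = b)
    (hc : ∀ s : T.cornersAt v, Q.Congruent (T.tile s.1.1) → (T.tile s.1.1).angle s.1.2 = γ →
      f s = c) :
    ∑ s, f s = T.numCorners P v * a + T.numAngles Q β v * b + T.numAngles Q γ v * c := by
  classical
  simp only [numCorners, numAngles, ncard_cornersAt_sep, Nat.cast_sum, Finset.sum_mul,
    ← Finset.sum_add_distrib]
  refine Finset.sum_congr rfl fun s _ => ?_
  rcases H.corner_cases s.1 with hP | ⟨hQ, hβ⟩ | ⟨hQ, hγ⟩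
  · have hQ : ¬Q.Congruent (T.tile s.1.1) := fun hQ => H.not_congruent hQ hP
    simp [ha s hP, hP, hQ]
  · simp [hb s hQ hβ, hQ, hβ, H.not_congruent hQ, H.lt.ne']
  · simp [hc s hQ hγ, hQ, hγ, H.not_congruent hQ, H.lt.ne]

theorem sum_angle (hv : (T.cornersAt v).Nonempty) :
    T.numCorners P v * α + T.numAngles Q β v * β + T.numAngles Q γ v * γ = 2 * π := by
  obtain ⟨A⟩ := T.nonempty_vertexArrangement hv
  rw [← A.sum_angle, finsum_eq_sum_of_fintype]
  exact (H.sum_corners (fun s hs => H.angle_eq hs _) (fun _ _ h => h) (fun _ _ h => h)).symm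

theorem three_le_degree (hv : (T.cornersAt v).Nonempty) :
    3 ≤ T.numCorners P v + T.numAngles Q β v + T.numAngles Q γ v := by
  have hcount := H.sum_corners (v := v) (f := fun _ => 1) (fun _ _ => rfl) (fun _ _ _ => rfl)
    (fun _ _ _ => rfl)
  rw [Finset.sum_const, Finset.card_univ, ← Nat.card_eq_fintype_card, Nat.card_coe_set_eq,
    nsmul_one, mul_one, mul_one, mul_one] at hcount
  obtain ⟨⟨j, i⟩, rfl⟩ := hv
  have hdegree : 3 ≤ (T.cornersAt ((T.tile j).vertex i)).ncard := T.three_le_degree j i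
  exact hdegree.trans_eq (by exact_mod_cast hcount)

open Classical in
/-- Every edge of length `y` at a vertex is shared by two quadrilaterals. -/
theorem numAngles_add_numAngles (A : T.VertexArrangement v) :
    T.numAngles Q β v + T.numAngles Q γ v =
      2 * (Finset.univ.filter fun c : T.cornersAt v =>
        S2.sphDist v ((T.tile c.1.1).vertex (A.en c)) = y).card := by
  let F (c : T.cornersAt v) : ℝ :=
    if S2.sphDist v ((T.tile c.1.1).vertex (A.st c)) = y then 1 else 0
  let G (c : T.cornersAt v) : ℝ :=
    if S2.sphDist v ((T.tile c.1.1).vertex (A.en c)) = y then 1 else 0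
  have hFG : ∑ c, F c = ∑ c, G c := by
    rw [← Equiv.sum_comp A.next F]
    simp only [F, G, A.vertex_next]
  have hG : ∑ c, G c = (Finset.univ.filter fun c : T.cornersAt v =>
      S2.sphDist v ((T.tile c.1.1).vertex (A.en c)) = y).card := Finset.sum_boole _ _
  have hxy := H.quad.1
  have hquad (c : T.cornersAt v) (hc : Q.Congruent (T.tile c.1.1)) : F c + G c = 1 := by
    rcases H.sphDist_of_quad A hc with ⟨hst, hen⟩ | ⟨hst, hen⟩ <;> simp [F, G, hst, hen, hxy]
  have hsum := H.sum_corners (f := fun c => F c + G c) (a := 0)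
    (fun c hc => by simp [F, G, H.sphDist_of_regular hc (A.isNext_st c),
      H.sphDist_of_regular hc (A.isNext_en c), hxy])
    (fun c hc _ => hquad c hc) (fun c hc _ => hquad c hc)
  rw [Finset.sum_add_distrib, hFG, hG, mul_zero, mul_one, mul_one, zero_add, ← two_mul] at hsum
  exact_mod_cast hsum.symm

theorem even_numAngles_add_numAngles (hv : (T.cornersAt v).Nonempty) :
    Even (T.numAngles Q β v + T.numAngles Q γ v) := by
  classical
  obtain ⟨A⟩ := T.nonempty_vertexArrangement hv
  rw [H.numAngles_add_numAngles A]
  exact even_two_mul _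

theorem hasEdge_en_iff (A : T.VertexArrangement v) {c : T.cornersAt v}
    (hc : P.Congruent (T.tile c.1.1)) :
    T.HasEdge Q v ((T.tile c.1.1).vertex (A.en c)) ↔ Q.Congruent (T.tile (A.next c).1.1) := by
  constructor
  · rintro ⟨l, j, j', hl, hj, hjv, hj'⟩
    have hne : (⟨⟨l, j⟩, hjv⟩ : T.cornersAt v) ≠ c := by
      rintro rfl
      exact H.not_congruent hl hc
    rwa [← A.eq_next hne hj hj']
  · exact fun h => ⟨_, (A.next c).1.2, A.st (A.next c), h, A.isNext_st _, (A.next c).2,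
      (A.vertex_next c).symm⟩

theorem hasEdge_of_numCorners_eq_one {k : Fin T.numTiles} (hk : P.Congruent (T.tile k))
    {i i' : ZMod (T.sides k)} (hi : IsNext i i') (hone : T.numCorners P ((T.tile k).vertex i) = 1) :
    T.HasEdge Q ((T.tile k).vertex i) ((T.tile k).vertex i') := by
  let c : T.cornersAt ((T.tile k).vertex i) := ⟨⟨k, i⟩, rfl⟩
  obtain ⟨A, rfl⟩ : ∃ A : T.VertexArrangement ((T.tile k).vertex i), A.en c = i' := by
    obtain ⟨A, hst, hen⟩ := exists_vertexArrangement_st_en c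
    rcases hi with rfl | rfl
    · exact ⟨A, hen⟩
    · exact ⟨A.reverse, hst⟩
  exact (H.hasEdge_en_iff A (c := c) hk).2 <| (H.dihedral.1 _).resolve_left fun hP =>
    A.next_ne c (eq_of_numCorners_eq_one hone hP hk)

theorem sphDist_en_next (A : T.VertexArrangement v) {c : T.cornersAt v}
    (hc : P.Congruent (T.tile c.1.1)) (hnext : Q.Congruent (T.tile (A.next c).1.1)) :
    S2.sphDist v ((T.tile (A.next c).1.1).vertex (A.en (A.next c))) = y := by
  rcases H.sphDist_of_quad A hnext with ⟨-, hen⟩ | ⟨hst, -⟩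
  · exact hen
  · rw [← A.vertex_next, H.sphDist_of_regular hc (A.isNext_en c)] at hst
    exact absurd hst H.quad.1

section TwoCorners

variable (hP : T.numCorners P v = 2) (A : T.VertexArrangement v) {c : T.cornersAt v}
  (hc : P.Congruent (T.tile c.1.1))
include hP hc

theorem quad_next_or_quad_prev (hα : α < π) :
    Q.Congruent (T.tile (A.next c).1.1) ∨ Q.Congruent (T.tile (A.next.symm c).1.1) := by
  obtain ⟨c', -, hc', hunique⟩ := exists_eq_of_numCorners_eq_two hP hc
  by_contra! hnot
  have hnext : A.next c = c' := hunique _ (A.next_ne c) ((H.dihedral.1 _).resolve_right hnot.1)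
  have hprev : A.next.symm c = c' :=
    hunique _ (A.reverse.next_ne c) ((H.dihedral.1 _).resolve_right hnot.2)
  have hangle := A.add_angle c (by rw [hnext, ← hprev, Equiv.apply_symm_apply])
  rw [hnext, H.angle_eq hc, H.angle_eq hc'] at hangle
  linarith

theorem not_quad_next_and_quad_prev
    (hQ : T.numAngles Q β v + T.numAngles Q γ v = 2) :
    ¬(Q.Congruent (T.tile (A.next c).1.1) ∧ Q.Congruent (T.tile (A.next.symm c).1.1)) := by
  classical
  rintro ⟨hnext, hprev⟩
  obtain ⟨c', hne, hc', hunique⟩ := exists_eq_of_numCorners_eq_two hP hc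
  have hnext' : Q.Congruent (T.tile (A.next c').1.1) := by
    refine (H.dihedral.1 _).resolve_left fun h => ?_
    have hcycle : A.next c' = c := by_contra fun hne' => A.next_ne c' (hunique _ hne' h)
    rw [← hcycle, Equiv.symm_apply_apply] at hprev
    exact H.not_congruent hprev hc'
  have hcard : (Finset.univ.filter fun c : T.cornersAt v =>
      S2.sphDist v ((T.tile c.1.1).vertex (A.en c)) = y).card ≤ 1 := by
    have := H.numAngles_add_numAngles A
    omega
  exact hne (A.next.injective (Finset.card_le_one.1 hcard _
    (Finset.mem_filter.2 ⟨Finset.mem_univ _, H.sphDist_en_next A hc' hnext'⟩) _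
    (Finset.mem_filter.2 ⟨Finset.mem_univ _, H.sphDist_en_next A hc hnext⟩)))

end TwoCorners

theorem hasEdge_add_one_iff (hα : α < π) {k : Fin T.numTiles} (hk : P.Congruent (T.tile k))
    (i : ZMod (T.sides k)) (hP : T.numCorners P ((T.tile k).vertex i) = 2)
    (hQ : T.numAngles Q β ((T.tile k).vertex i) + T.numAngles Q γ ((T.tile k).vertex i) = 2) :
    T.HasEdge Q ((T.tile k).vertex i) ((T.tile k).vertex (i + 1)) ↔
      ¬T.HasEdge Q ((T.tile k).vertex i) ((T.tile k).vertex (i - 1)) := by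
  let c : T.cornersAt ((T.tile k).vertex i) := ⟨⟨k, i⟩, rfl⟩
  obtain ⟨A, hst, hen⟩ := exists_vertexArrangement_st_en c
  have hnext := H.hasEdge_en_iff A (c := c) hk
  have hprev := H.hasEdge_en_iff A.reverse (c := c) hk
  rw [show A.en c = i + 1 from hen] at hnext
  rw [show A.reverse.en c = i - 1 from hst] at hprev
  have hor := H.quad_next_or_quad_prev hP A (c := c) hk hα
  have hnot := H.not_quad_next_and_quad_prev hP A (c := c) hk hQ
  rw [hnext, hprev]
  exact ⟨fun h h' => hnot ⟨h, h'⟩, hor.resolve_right⟩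

theorem numAngles_pos_of_hasEdge {p q : S2} (h : T.HasEdge Q p q) :
    (0 < T.numAngles Q β p ∧ 0 < T.numAngles Q γ q) ∨
    (0 < T.numAngles Q γ p ∧ 0 < T.numAngles Q β q) := by
  obtain ⟨l, j, j', hl, hj, rfl, rfl⟩ := h
  exact ((H.alternates hl).angle_of_isNext hj).imp
    (And.imp (numAngles_pos hl) (numAngles_pos hl)) (And.imp (numAngles_pos hl) (numAngles_pos hl))

end IsRegularQuadTiling

end SphericalTiling

/-! ### Tilings with a vertex of type `αβ²` -/

/-- The relations between the angles of `P` and `Q` in the presence of a vertex of type `αβ²`. -/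
structure AngleRelations (α β γ : ℝ) : Prop where
  lt : γ < β
  add_two_mul : α + 2 * β = 2 * π
  pi_lt_add : π < β + γ
  pi_lt_two_mul : π < 2 * α

namespace AngleRelations

variable {α β γ : ℝ} (hR : AngleRelations α β γ) {a b c : ℕ}
include hR

theorem lt_pi : α < π := by
  linarith [hR.lt, hR.add_two_mul, hR.pi_lt_add]

theorem vertex_cases (hangle : a * α + b * β + c * γ = 2 * π) (hdegree : 3 ≤ a + b + c)
    (heven : Even (b + c)) :
    (a = 1 ∧ b = 2 ∧ c = 0) ∨ (a = 3 ∧ b = 0 ∧ c = 0) ∨ (a = 2 ∧ b = 0 ∧ c = 2) ∨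
      (a = 1 ∧ b = 0 ∧ c = 4) ∨ (a = 0 ∧ b < c) := by
  obtain ⟨hγβ, hαβ, hβγ, hα⟩ := hR
  have : α < 2 * γ := by linarith
  have : π < 2 * β := by linarith
  have := Real.pi_pos
  have haα : 0 ≤ a * α := mul_nonneg a.cast_nonneg (by linarith)
  have hbβ : 0 ≤ b * β := mul_nonneg b.cast_nonneg (by linarith)
  have hcγ : 0 ≤ c * γ := mul_nonneg c.cast_nonneg (by linarith)
  have lt_of_mul {n k : ℕ} {t : ℝ} (hn : n * t ≤ 2 * π) (ht : 0 < t) (hk : 2 * π < k * t) :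
      n < k := by exact_mod_cast lt_of_mul_lt_mul_right (hn.trans_lt hk) ht.le
  have ha : a < 4 := lt_of_mul (t := α) (by linarith) (by linarith) (by push_cast; linarith)
  have hb : b < 4 := lt_of_mul (t := β) (by linarith) (by linarith) (by push_cast; linarith)
  have hc : c < 8 := lt_of_mul (t := γ) (by linarith) (by linarith) (by push_cast; linarith)
  obtain ⟨d, hd⟩ := heven
  clear haα hbβ hcγ lt_of_mul
  interval_cases a <;> interval_cases b <;> interval_cases c <;>
    first
    | omega
    | (push_cast at hangle; linarith)

end AngleRelations

theorem not_of_periodic {n : ℕ} (hn : n = 4 ∨ n = 5) {B : ZMod n → Prop}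
    (hB : ∀ i, B i → ¬B (i + 1) ∧ B (i + 1 + 1 + 1)) (i : ZMod n) : ¬B i := by
  intro hi
  have hi₃ := (hB i hi).2
  rcases hn with rfl | rfl
  · have hcycle : ∀ j : ZMod 4, j + 1 + 1 + 1 + 1 = j := by decide
    exact (hB _ hi₃).1 ((hcycle i).symm ▸ hi)
  · have hcycle : ∀ j : ZMod 5, j + 1 + 1 + 1 + 1 + 1 + 1 = j + 1 := by decide
    exact (hB i hi).1 (hcycle i ▸ (hB _ hi₃).2)

namespace SphericalTiling

open SphericalPolygon

variable (T : SphericalTiling)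

theorem sum_add_one_eq (f : (Σ k, ZMod (T.sides k)) → ℝ) :
    ∑ s : Σ k, ZMod (T.sides k), f ⟨s.1, s.2 + 1⟩ = ∑ s, f s :=
  Equiv.sum_comp (Equiv.sigmaCongrRight fun k => Equiv.addRight (1 : ZMod (T.sides k))) f

theorem sum_nonneg_of_cornersAt {f : (Σ k, ZMod (T.sides k)) → ℝ}
    (hf : ∀ v, (T.cornersAt v).Nonempty → 0 ≤ ∑ s : T.cornersAt v, f s) : 0 ≤ ∑ s, f s := by
  classical
  let V (s : Σ k, ZMod (T.sides k)) : S2 := (T.tile s.1).vertex s.2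
  rw [← Finset.sum_fiberwise_of_maps_to (g := V)
    (fun s _ => Finset.mem_image_of_mem V (Finset.mem_univ s))]
  refine Finset.sum_nonneg fun v hv => ?_
  obtain ⟨s, -, hs⟩ := Finset.mem_image.1 hv
  rw [Finset.sum_subtype (p := fun s => s ∈ T.cornersAt v) _
    (fun s => by simp only [Finset.mem_filter, Finset.mem_univ, true_and]; rfl)]
  exact hf v ⟨s, hs⟩

open Classical in
/-- The weight of a corner in the count of the angles `β` against the angles `γ`. -/
noncomputable def quadWeight (Q : SphericalPolygon 4) (β : ℝ) (s : Σ k, ZMod (T.sides k)) : ℝ :=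
  if Q.Congruent (T.tile s.1) then if (T.tile s.1).angle s.2 = β then 1 else -1 else 0

open Classical in
/-- The excess of angles `β` over angles `γ` at the vertex of a corner of `P`, if this vertex has
type `αβ²` or `αγ⁴`. -/
noncomputable def excess {m : ℕ} (P : SphericalPolygon m) (Q : SphericalPolygon 4) (β : ℝ)
    (s : Σ k, ZMod (T.sides k)) : ℝ :=
  if P.Congruent (T.tile s.1) then
    if 0 < T.numAngles Q β ((T.tile s.1).vertex s.2) then 2 else -4
  else 0

namespace IsRegularQuadTiling

variable {T} {m : ℕ} {P : SphericalPolygon m} {Q : SphericalPolygon 4} {x y α β γ : ℝ}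
  (H : T.IsRegularQuadTiling P Q x y α β γ)
include H

theorem sum_quadWeight : ∑ s, T.quadWeight Q β s = 0 := by
  have hneg (s : Σ k, ZMod (T.sides k)) :
      T.quadWeight Q β ⟨s.1, s.2 + 1⟩ = -T.quadWeight Q β s := by
    by_cases hs : Q.Congruent (T.tile s.1)
    · rcases (H.alternates hs s.2).1 with ⟨hβ, hγ⟩ | ⟨hγ, hβ⟩ <;>
        simp [quadWeight, hs, hβ, hγ, H.lt.ne]
    · simp [quadWeight, hs]
  have hsum := T.sum_add_one_eq (T.quadWeight Q β)
  simp only [hneg, Finset.sum_neg_distrib] at hsum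
  linarith

theorem sum_excess_neg
    (halt : ∀ k, P.Congruent (T.tile k) → ∀ i, 0 < T.numAngles Q β ((T.tile k).vertex i) →
      ¬0 < T.numAngles Q β ((T.tile k).vertex (i + 1))) :
    ∑ s, T.excess P Q β s < 0 := by
  have hneg (k : Fin T.numTiles) (hk : P.Congruent (T.tile k)) (i : ZMod (T.sides k)) :
      T.excess P Q β ⟨k, i⟩ + T.excess P Q β ⟨k, i + 1⟩ < 0 := by
    simp only [excess, hk, if_true]
    split_ifs with hi hi'
    · exact absurd hi' (halt k hk i hi)
    all_goals norm_num
  have hnonpos (s : Σ k, ZMod (T.sides k)) :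
      T.excess P Q β s + T.excess P Q β ⟨s.1, s.2 + 1⟩ ≤ 0 := by
    by_cases hs : P.Congruent (T.tile s.1)
    · exact (hneg s.1 hs s.2).le
    · simp [excess, hs]
  obtain ⟨j, hj⟩ := H.dihedral.2.1
  have hsum := Finset.sum_lt_sum (fun s _ => hnonpos s)
    ⟨(⟨j, 0⟩ : Σ k, ZMod (T.sides k)), Finset.mem_univ _, hneg j hj 0⟩
  rw [Finset.sum_add_distrib, T.sum_add_one_eq, Finset.sum_const_zero] at hsum
  linarith

theorem sum_excess_sub_quadWeight_nonneg
    (htypes : ∀ v, (T.cornersAt v).Nonempty → T.IsOfType P Q β γ v 1 2 0 ∨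
      T.IsOfType P Q β γ v 1 0 4 ∨ T.numCorners P v = 0 ∧ T.numAngles Q β v < T.numAngles Q γ v) :
    0 ≤ ∑ s, (T.excess P Q β s - T.quadWeight Q β s) := by
  refine T.sum_nonneg_of_cornersAt fun v hv => ?_
  rw [H.sum_corners (a := if 0 < T.numAngles Q β v then 2 else -4) (b := -1) (c := 1)]
  · rcases htypes v hv with ⟨hP, hβ, hγ⟩ | ⟨hP, hβ, hγ⟩ | ⟨hP, hlt⟩
    · norm_num [hP, hβ, hγ]
    · norm_num [hP, hβ, hγ]
    · have : (T.numAngles Q β v : ℝ) < T.numAngles Q γ v := by exact_mod_cast hlt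
      rw [hP]
      push_cast
      linarith
  · intro s hs
    have hQ : ¬Q.Congruent (T.tile s.1.1) := fun h => H.not_congruent h hs
    simp [excess, quadWeight, hs, hQ, show (T.tile s.1.1).vertex s.1.2 = v from s.2]
  · intro s hs hβ
    simp [excess, quadWeight, hs, hβ, H.not_congruent hs]
  · intro s hs hγ
    simp [excess, quadWeight, hs, hγ, H.not_congruent hs, H.lt.ne]

theorem angleRelations {v : S2} (hm : 4 ≤ m) (hv : (T.cornersAt v).Nonempty)
    (htype : T.IsOfType P Q β γ v 1 2 0) : AngleRelations α β γ := by
  have hm' : (4 : ℝ) ≤ m := by exact_mod_cast hm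
  have hα : 0 < α := H.regular.2 0 ▸ (P.isInteriorAngle 0).1
  have hsum := H.sum_angle hv
  rw [htype.1, htype.2.1, htype.2.2] at hsum
  push_cast at hsum
  exact ⟨H.lt, by linarith, H.quad.pi_lt_add (by linarith [H.lt]),
    by nlinarith [H.regular.angle_gt, Real.pi_pos]⟩

variable (hR : AngleRelations α β γ)
include hR

theorem vertex_cases {v : S2} (hv : (T.cornersAt v).Nonempty) :
    T.IsOfType P Q β γ v 1 2 0 ∨ T.IsOfType P Q β γ v 3 0 0 ∨ T.IsOfType P Q β γ v 2 0 2 ∨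
      T.IsOfType P Q β γ v 1 0 4 ∨ T.numCorners P v = 0 ∧ T.numAngles Q β v < T.numAngles Q γ v :=
  hR.vertex_cases (H.sum_angle hv) (H.three_le_degree hv) (H.even_numAngles_add_numAngles hv)

/-- The edge between the two vertices also belongs to a copy of `Q`, which has an angle `γ` at the
second one. -/
theorem type_add_one {k : Fin T.numTiles} (hk : P.Congruent (T.tile k)) {i : ZMod (T.sides k)}
    (hi : T.IsOfType P Q β γ ((T.tile k).vertex i) 1 2 0) :
    T.IsOfType P Q β γ ((T.tile k).vertex (i + 1)) 2 0 2 ∨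
      T.IsOfType P Q β γ ((T.tile k).vertex (i + 1)) 1 0 4 := by
  have hγ := H.numAngles_pos_of_hasEdge (H.hasEdge_of_numCorners_eq_one hk (Or.inl rfl) hi.1)
  have hP := numCorners_pos hk (i + 1)
  have := H.vertex_cases hR (cornersAt_vertex_nonempty k (i + 1))
  omega

theorem false_of_type_one_zero_four {v : S2} (hv : (T.cornersAt v).Nonempty)
    (hvt : T.IsOfType P Q β γ v 1 0 4) : False := by
  have hangle := H.sum_angle hv
  rw [hvt.1, hvt.2.1, hvt.2.2] at hangle
  have htypes (w : S2) (hw : (T.cornersAt w).Nonempty) : T.IsOfType P Q β γ w 1 2 0 ∨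
      T.IsOfType P Q β γ w 1 0 4 ∨
      T.numCorners P w = 0 ∧ T.numAngles Q β w < T.numAngles Q γ w := by
    have hangle' := H.sum_angle hw
    have ⟨_, _, _, _⟩ := hR
    rcases H.vertex_cases hR hw with h | h | h | h
    · exact Or.inl h
    · rw [h.1, h.2.1, h.2.2] at hangle'
      push_cast at hangle hangle'
      linarith
    · rw [h.1, h.2.1, h.2.2] at hangle'
      push_cast at hangle hangle'
      linarith
    · exact Or.inr h
  have hneg := H.sum_excess_neg fun l hl j hj hj' => by
    have hP := numCorners_pos hl j
    have hP' := numCorners_pos hl (j + 1)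
    have ht := htypes _ (cornersAt_vertex_nonempty l j)
    have ht' := htypes _ (cornersAt_vertex_nonempty l (j + 1))
    have hedge := H.numAngles_pos_of_hasEdge
      (H.hasEdge_of_numCorners_eq_one hl (i' := j + 1) (Or.inl rfl) (by omega))
    omega
  have hnonneg := H.sum_excess_sub_quadWeight_nonneg htypes
  rw [Finset.sum_sub_distrib, H.sum_quadWeight] at hnonneg
  linarith

/-- The edges of the tile are shared with copies of `Q` in the pattern yes, no, yes, where the
first one starts at `i`. -/
theorem type_periodic {k : Fin T.numTiles} (hk : P.Congruent (T.tile k))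
    (htypes : ∀ i, T.IsOfType P Q β γ ((T.tile k).vertex i) 1 2 0 ∨
      T.IsOfType P Q β γ ((T.tile k).vertex i) 2 0 2)
    {i : ZMod (T.sides k)} (hi : T.IsOfType P Q β γ ((T.tile k).vertex i) 1 2 0) :
    ¬T.IsOfType P Q β γ ((T.tile k).vertex (i + 1)) 1 2 0 ∧
      T.IsOfType P Q β γ ((T.tile k).vertex (i + 1 + 1 + 1)) 1 2 0 := by
  let B (j : ZMod (T.sides k)) : Prop := T.IsOfType P Q β γ ((T.tile k).vertex j) 1 2 0
  let E (j j' : ZMod (T.sides k)) : Prop := T.HasEdge Q ((T.tile k).vertex j) ((T.tile k).vertex j')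
  have hB {j j' : ZMod (T.sides k)} (hj : B j) (hjj' : IsNext j j') : E j j' :=
    H.hasEdge_of_numCorners_eq_one hk hjj' hj.1
  have hnotB {j : ZMod (T.sides k)} (hj : ¬B j) : E j (j + 1) ↔ ¬E j (j - 1) :=
    have ⟨hP, hβ, hγ⟩ := (htypes j).resolve_left hj
    H.hasEdge_add_one_iff hR.lt_pi hk j hP (by rw [hβ, hγ])
  have hE {j j' : ZMod (T.sides k)} (h : E j j') : B j ↔ ¬B j' := by
    have := H.numAngles_pos_of_hasEdge h
    have := htypes j
    have := htypes j'
    simp only [B]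
    omega
  have hedge₁ : E i (i + 1) := hB hi (Or.inl rfl)
  have htype₁ : ¬B (i + 1) := (hE hedge₁).1 hi
  have hedge₂ : ¬E (i + 1) (i + 1 + 1) := fun h =>
    (hnotB htype₁).1 h (by rw [add_sub_cancel_right]; exact hedge₁.symm)
  have htype₂ : ¬B (i + 1 + 1) := fun h =>
    hedge₂ (hB h (Or.inr (add_sub_cancel_right _ _).symm)).symm
  have hedge₃ : E (i + 1 + 1) (i + 1 + 1 + 1) :=
    (hnotB htype₂).2 fun h => hedge₂ (by rw [add_sub_cancel_right] at h; exact h.symm)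
  exact ⟨htype₁, not_not.1 fun h => htype₂ ((hE hedge₃).2 h)⟩

theorem false_of_type_two_zero_two (hm : 4 ≤ m) {k : Fin T.numTiles}
    (hk : P.Congruent (T.tile k)) {i : ZMod (T.sides k)}
    (hi : T.IsOfType P Q β γ ((T.tile k).vertex i) 1 2 0)
    (hi' : T.IsOfType P Q β γ ((T.tile k).vertex (i + 1)) 2 0 2) : False := by
  have ⟨_, _, _, _⟩ := hR
  have hangle := H.sum_angle (cornersAt_vertex_nonempty k (i + 1))
  rw [hi'.1, hi'.2.1, hi'.2.2] at hangle
  push_cast at hangle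
  have htypes (j : ZMod (T.sides k)) : T.IsOfType P Q β γ ((T.tile k).vertex j) 1 2 0 ∨
      T.IsOfType P Q β γ ((T.tile k).vertex j) 2 0 2 := by
    have hne := cornersAt_vertex_nonempty k j
    have hP := numCorners_pos hk j
    have hangle' := H.sum_angle hne
    rcases H.vertex_cases hR hne with h | h | h | h | h
    · exact Or.inl h
    · rw [h.1, h.2.1, h.2.2] at hangle'
      push_cast at hangle'
      linarith
    · exact Or.inr h
    · rw [h.1, h.2.1, h.2.2] at hangle'
      push_cast at hangle'
      linarith
    · omega
  have hm6 : m < 6 := by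
    by_contra! hm6
    have : (6 : ℝ) ≤ m := by exact_mod_cast hm6
    nlinarith [H.regular.angle_gt]
  have hsides : T.sides k = 4 ∨ T.sides k = 5 := by
    have := hk.sides_eq
    omega
  exact not_of_periodic hsides (B := fun j => T.IsOfType P Q β γ ((T.tile k).vertex j) 1 2 0)
    (fun j hj => H.type_periodic hR hk htypes hj) i hi

end IsRegularQuadTiling

end SphericalTiling

theorem proposition3p2 (m : ℕ) (hm : 4 ≤ m) (x y α β γ : ℝ)
    (P : SphericalPolygon m) (hP : P.IsRegular x α)
    (Q : SphericalPolygon 4) (hQ : Q.HasEqualOppositeEdges x y β γ) (hβγ : γ < β)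
    (T : SphericalTiling) (hT : T.IsDihedral P Q) :
    ¬ T.HasVertexOfType P Q β γ 1 2 0 := by
  rintro ⟨v, hv, htype : T.IsOfType P Q β γ v 1 2 0⟩
  have H : T.IsRegularQuadTiling P Q x y α β γ := ⟨hP, hQ, hβγ, hT⟩
  have hR : AngleRelations α β γ := H.angleRelations hm hv htype
  have hcorner : 0 < T.numCorners P v := htype.1.symm ▸ one_pos
  obtain ⟨k, i, hk, rfl⟩ := SphericalTiling.exists_vertex_eq_of_numCorners_pos hcorner
  rcases H.type_add_one hR hk htype with h | h
  · exact H.false_of_type_two_zero_two hR hm hk htype h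
  · exact H.false_of_type_one_zero_four hR (SphericalTiling.cornersAt_vertex_nonempty k _) h
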